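/- For functions $a,b$ on $\mathbb{Z}$ write $(a*b)(k)=\sum_{j\in\mathbb{Z}}a(j)b(k-j)$, let $\delta_0$ be the unit mass at $0$, and let $a^{*n}$ be the $n$-th convolution power, with $a^{*0}=\delta_0$. A probability measure $\mu$ on $\mathbb{Z}$ is called SCM (symmetric with completely monotone coefficients) if $\mu(-n)=\mu(n)$ for every $n\in\mathbb{Z}$ and there is a finite positive measure $\nu$ on $[0,1]$ such that $$\int_{[0,1]}\frac{\nu(dt)}{1-t}=\frac12,\qquad \mu(0)=2\int_{[0,1]}\nu(dt),\qquad \mu(n)=\int_{[0,1]}t^n\,\nu(dt)\quad\text{for every } n\ge 1,$$ where $1/(1-t)=+\infty$ at $t=1$. **Theorem.** Let $\mu$ be an SCM probability measure on $\mathbb{Z}$ that satisfies at least one of the following two conditions: 1. there exists $D>0$ such that $\displaystyle\sum_{k=1}^n k\mu(k)\le D\,n\sum_{k\ge n}\mu(k)$ for every integer $n\ge1$; 2. there exists $L>0$ such that $\displaystyle n^2\sum_{k\ge n}\mu(k)\le L\sum_{k=1}^n k^2\mu(k)$ for every integer $n\ge1$. Then $\mu$ is Ritt, that is, $$\sup_{n\ge1}\,n\,\|\mu^{*n}-\mu^{*(n+1)}\|_{\ell^1(\mathbb{Z})}<\infty,$$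 and for every integer $m\ge0$ there exists $C_m>0$ such that for every $f\in\ell^1(\mathbb{Z})$ (complex valued) $$\sup_{\lambda>0}\lambda\,\#\Big\{k\in\mathbb{Z}:\ \sup_{n\ge1}n^m\big|\big(\mu^{*n}*(\delta_0-\mu)^{*m}*f\big)(k)\big|\ge\lambda\Big\}\le C_m\|f\|_{\ell^1(\mathbb{Z})}.$$ -/

import Mathlib

open MeasureTheory
open scoped ENNReal

noncomputable section

namespace RittSCM

/-- The weights `n ↦ μ(n) = μ {n}` of a measure on `ℤ`, as complex numbers. -/
def weight (μ : Measure ℤ) : ℤ → ℂ := fun n => ((μ.real {n} : ℝ) : ℂ)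

/-- The unit mass `δ₀` at `0`. -/
def delta : ℤ → ℂ := Pi.single 0 1

/-- Convolution on `ℤ`: `(a * b)(x) = ∑_{i + j = x} a(i) b(j)`. -/
def conv (a b : ℤ → ℂ) : ℤ → ℂ :=
  DiscreteConvolution.addConvolution (LinearMap.mul ℂ ℂ) a b

/-- The usual form of the convolution, `(a * b)(x) = ∑_j a(j) b(x - j)`. -/
theorem conv_apply (a b : ℤ → ℂ) (x : ℤ) : conv a b x = ∑' j : ℤ, a j * b (x - j) := by
  let e : ℤ ≃ DiscreteConvolution.addFiber x :=
    { toFun := fun j => ⟨(j, x - j), by simp [DiscreteConvolution.mem_addFiber]⟩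
      invFun := fun p => p.1.1
      left_inv := fun j => rfl
      right_inv := fun p => by
        obtain ⟨⟨i, j⟩, h⟩ := p
        rw [DiscreteConvolution.mem_addFiber] at h
        ext
        · rfl
        · simp only at h ⊢
          omega }
  unfold conv DiscreteConvolution.addConvolution
  rw [← e.tsum_eq]
  rfl

/-- Convolution powers `a^{*n}`, with `a^{*0} = δ₀`. -/
def convPow (a : ℤ → ℂ) : ℕ → ℤ → ℂ
  | 0 => delta
  | n + 1 => conv a (convPow a n)

/-- `μ` is SCM: it is symmetric and there is a finite positive measure `ν` on `[0, 1]` with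
`∫ (1 - t)⁻¹ ν(dt) = 1/2`, `μ(0) = 2 ∫ ν(dt)` and `μ(n) = ∫ tⁿ ν(dt)` for `n ≥ 1`.
The integrals are Lebesgue integrals in `[0, ∞]`, so that `(1 - t)⁻¹ = ∞` at `t = 1`. -/
def IsSCM (μ : Measure ℤ) : Prop :=
  (∀ n : ℤ, μ {-n} = μ {n}) ∧
    ∃ ν : Measure (Set.Icc (0 : ℝ) 1), IsFiniteMeasure ν ∧
      ∫⁻ t, (ENNReal.ofReal (1 - (t : ℝ)))⁻¹ ∂ν = 1 / 2 ∧
      μ {0} = 2 * ∫⁻ _, 1 ∂ν ∧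
      ∀ n : ℕ, 1 ≤ n → μ {(n : ℤ)} = ∫⁻ t, ENNReal.ofReal ((t : ℝ) ^ n) ∂ν

/-- `∑_{k=1}^n k μ(k) ≤ D n ∑_{k ≥ n} μ(k)` for all `n ≥ 1` and some `D > 0`. -/
def FirstMomentCondition (μ : Measure ℤ) : Prop :=
  ∃ D : ℝ, 0 < D ∧ ∀ n : ℕ, 1 ≤ n →
    ∑ k ∈ Finset.Icc 1 n, (k : ℝ) * μ.real {(k : ℤ)} ≤
      D * n * ∑' j : ℕ, μ.real {((n + j : ℕ) : ℤ)}

/-- `n² ∑_{k ≥ n} μ(k) ≤ L ∑_{k=1}^n k² μ(k)` for all `n ≥ 1` and some `L > 0`. -/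
def SecondMomentCondition (μ : Measure ℤ) : Prop :=
  ∃ L : ℝ, 0 < L ∧ ∀ n : ℕ, 1 ≤ n →
    (n : ℝ) ^ 2 * ∑' j : ℕ, μ.real {((n + j : ℕ) : ℤ)} ≤
      L * ∑ k ∈ Finset.Icc 1 n, (k : ℝ) ^ 2 * μ.real {(k : ℤ)}

/-- `μ` is Ritt: `sup_{n ≥ 1} n ‖μ^{*n} - μ^{*(n+1)}‖_{ℓ¹(ℤ)} < ∞`.
The `ℓ¹` norm is computed in `[0, ∞]`. -/
def IsRitt (μ : Measure ℤ) : Prop :=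
  (⨆ (n : ℕ) (_ : 1 ≤ n), (n : ℝ≥0∞) *
    ∑' k : ℤ, ‖convPow (weight μ) n k - convPow (weight μ) (n + 1) k‖ₑ) < ∞

/-- The maximal function `k ↦ sup_{n ≥ 1} n^m |μ^{*n} * (δ₀ - μ)^{*m} * f (k)|`,
with values in `[0, ∞]`. -/
def maximalFunction (μ : Measure ℤ) (m : ℕ) (f : ℤ → ℂ) (k : ℤ) : ℝ≥0∞ :=
  ⨆ (n : ℕ) (_ : 1 ≤ n), (n : ℝ≥0∞) ^ m *
    ‖conv (conv (convPow (weight μ) n) (convPow (delta - weight μ) m)) f k‖ₑ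

/-- The weak type `(1,1)` maximal inequality of order `m`: for some `C > 0` and all `f ∈ ℓ¹(ℤ)`,
`sup_{s > 0} s #{k ∈ ℤ : sup_{n ≥ 1} n^m |μ^{*n} * (δ₀ - μ)^{*m} * f (k)| ≥ s} ≤ C ‖f‖_{ℓ¹}`. -/
def WeakTypeMaximal (μ : Measure ℤ) (m : ℕ) : Prop :=
  ∃ C : ℝ, 0 < C ∧ ∀ f : lp (fun _ : ℤ => ℂ) 1,
    (⨆ (s : ℝ) (_ : 0 < s), ENNReal.ofReal s *
      ((({k : ℤ | ENNReal.ofReal s ≤ maximalFunction μ m f k}).encard : ℕ∞) : ℝ≥0∞)) ≤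
        ENNReal.ofReal (C * ‖f‖)

end RittSCM

end

namespace RittSCM

/-! ### The convolution algebra `ℓ¹(ℤ)` -/

/-! Let `p` be the weight sequence of μ, in the Banach algebra ℓ¹(ℤ). Summing a geometric series
under ν shows that its Fourier transform is ψ(1 - cos θ), where ψ is `symbol ν`. For y > 0 the
function ψ is decreasing and convex with values in [0, 1], and it satisfies the scale-invariant
bounds -yψ' ≤ 1 - ψ (`mul_symbolDeriv_le`) and yψ'' ≤ -2ψ' (`mul_symbolDeriv₂_le`).

Ritt property. The coefficients of p^n(1 - p) are the cosine coefficients of φ(θ) = P(ψ(1 - cos θ))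
with P(u) = u^n - u^(n+1). Two integrations by parts bound the k-th one by ∫ |φ''| (1 - cos kθ)/k²,
and the sum of these weights over k is O(θ); so it is enough that ∫ θ|φ''| = O(1/n). The bounds on ψ
give |φ''| ≤ |ψ'| G(ψ) for a polynomial G with ∫₀¹ G = O(1/n), and the change of variables u = ψ(1 -
cos θ) removes ψ from the estimate (`integral_mul_abs_symbolGapDeriv₂_le`).

Maximal inequalities. Put δa(i) = (i + 1)a(i + 1) - i a(i). Multiplication by i is a derivation for
convolution, and δ is this derivation followed by convolution with a fixed finitely supported
sequence, so δ obeys the Leibniz rule. If a is symmetric and unimodal then ‖δa‖ ≤ 4‖a‖. Convolution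
preserves this class, so the powers of p belong to it, whence n‖p^(n-1) δp‖ ≤ 4. Together with the
Ritt bound, and by sharing the power of p between the factors, this gives n^m(‖K‖ + ‖δK‖) ≤ C for K
= p^n(1 - p)^m (`exists_scaleDiff_bound`). Summation by parts dominates K by a superposition of
indicators of centred balls whose total mass is at most 4(‖K‖ + ‖δK‖). The maximal function is
therefore at most a multiple of the Hardy–Littlewood one, which is of weak type (1,1) by Vitali
covering. -/

/-- The trigonometric series `θ ↦ ∑ a(k) e^{ikθ}`. -/
noncomputable def trigSeries (a : ℤ → ℂ) (θ : ℝ) : ℂ :=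
  ∑' k : ℤ, a k * Complex.exp (k * θ * Complex.I)

theorem norm_exp_int_mul (k : ℤ) (θ : ℝ) : ‖Complex.exp (k * θ * Complex.I)‖ = 1 := by
  have := Complex.norm_exp_ofReal_mul_I ((k : ℝ) * θ)
  push_cast at this
  exact this

theorem norm_mul_exp_int (a : ℤ → ℂ) (k : ℤ) (θ : ℝ) :
    ‖a k * Complex.exp (k * θ * Complex.I)‖ = ‖a k‖ := by
  rw [norm_mul, norm_exp_int_mul, mul_one]

theorem summable_mul_exp {a : ℤ → ℂ} (ha : Summable fun k => ‖a k‖) (θ : ℝ) :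
    Summable fun k : ℤ => a k * Complex.exp (k * θ * Complex.I) :=
  Summable.of_norm (by simpa only [norm_mul_exp_int] using ha)

/-- The change of variables `(k, j) ↦ (j, k - j)`. -/
def convEquiv : ℤ × ℤ ≃ ℤ × ℤ where
  toFun p := (p.2, p.1 - p.2)
  invFun p := (p.1 + p.2, p.1)
  left_inv p := by ext <;> simp
  right_inv p := by ext <;> simp

theorem summable_norm_conv_aux {a b : ℤ → ℂ} (ha : Summable fun k => ‖a k‖)
    (hb : Summable fun k => ‖b k‖) :
    Summable fun p : ℤ × ℤ => ‖a p.2 * b (p.1 - p.2)‖ :=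
  convEquiv.summable_iff.mpr (ha.mul_norm hb)

theorem norm_conv_le {a b : ℤ → ℂ} (ha : Summable fun k => ‖a k‖)
    (hb : Summable fun k => ‖b k‖) (k : ℤ) :
    ‖conv a b k‖ ≤ ∑' j : ℤ, ‖a j * b (k - j)‖ := by
  rw [conv_apply]
  exact norm_tsum_le_tsum_norm ((summable_norm_conv_aux ha hb).prod_factor k)

theorem summable_norm_conv {a b : ℤ → ℂ} (ha : Summable fun k => ‖a k‖)
    (hb : Summable fun k => ‖b k‖) : Summable fun k => ‖conv a b k‖ :=
  Summable.of_nonneg_of_le (fun _ => norm_nonneg _) (norm_conv_le ha hb)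
    (summable_norm_conv_aux ha hb).prod

theorem tsum_norm_conv_le {a b : ℤ → ℂ} (ha : Summable fun k => ‖a k‖)
    (hb : Summable fun k => ‖b k‖) :
    ∑' k, ‖conv a b k‖ ≤ (∑' k, ‖a k‖) * ∑' k, ‖b k‖ := by
  calc ∑' k, ‖conv a b k‖ ≤ ∑' k, ∑' j : ℤ, ‖a j * b (k - j)‖ :=
        (summable_norm_conv ha hb).tsum_le_tsum (norm_conv_le ha hb)
          (summable_norm_conv_aux ha hb).prod
    _ = ∑' p : ℤ × ℤ, ‖a p.2 * b (p.1 - p.2)‖ :=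
        ((summable_norm_conv_aux ha hb).tsum_prod).symm
    _ = ∑' p : ℤ × ℤ, ‖a p.1 * b p.2‖ :=
        convEquiv.tsum_eq fun p : ℤ × ℤ => ‖a p.1 * b p.2‖
    _ = (∑' k, ‖a k‖) * ∑' k, ‖b k‖ := by
        simp_rw [norm_mul]
        exact (tsum_mul_tsum_of_summable_norm (f := fun k => ‖a k‖) (g := fun k => ‖b k‖)
          (by simpa only [norm_norm] using ha) (by simpa only [norm_norm] using hb)).symm

theorem trigSeries_conv {a b : ℤ → ℂ} (ha : Summable fun k => ‖a k‖)
    (hb : Summable fun k => ‖b k‖) (θ : ℝ) :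
    trigSeries (conv a b) θ = trigSeries a θ * trigSeries b θ := by
  have key : ∀ p : ℤ × ℤ, a p.2 * b (p.1 - p.2) * Complex.exp (p.1 * θ * Complex.I)
      = (a p.2 * Complex.exp (p.2 * θ * Complex.I)) *
        (b (p.1 - p.2) * Complex.exp ((p.1 - p.2 : ℤ) * θ * Complex.I)) := by
    intro p
    have : Complex.exp (p.1 * θ * Complex.I) = Complex.exp (p.2 * θ * Complex.I) *
        Complex.exp ((p.1 - p.2 : ℤ) * θ * Complex.I) := by
      rw [← Complex.exp_add]
      push_cast
      ring_nf
    rw [this]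
    ring
  have hs : Summable fun p : ℤ × ℤ =>
      a p.2 * b (p.1 - p.2) * Complex.exp (p.1 * θ * Complex.I) := by
    refine Summable.of_norm ((summable_norm_conv_aux ha hb).congr fun p => ?_)
    rw [norm_mul (_ * _), norm_exp_int_mul, mul_one]
  unfold trigSeries
  rw [tsum_mul_tsum_of_summable_norm (by simpa only [norm_mul_exp_int] using ha)
    (by simpa only [norm_mul_exp_int] using hb),
    ← convEquiv.tsum_eq fun p : ℤ × ℤ => (a p.1 * Complex.exp (p.1 * θ * Complex.I)) *
      (b p.2 * Complex.exp (p.2 * θ * Complex.I))]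
  change _ = ∑' p : ℤ × ℤ, (a p.2 * Complex.exp (p.2 * θ * Complex.I)) *
        (b (p.1 - p.2) * Complex.exp ((p.1 - p.2 : ℤ) * θ * Complex.I))
  rw [← tsum_congr key, hs.tsum_prod]
  refine tsum_congr fun k => ?_
  rw [conv_apply, ← tsum_mul_right]

theorem trigSeries_add {a b : ℤ → ℂ} (ha : Summable fun k => ‖a k‖)
    (hb : Summable fun k => ‖b k‖) (θ : ℝ) :
    trigSeries (a + b) θ = trigSeries a θ + trigSeries b θ := by
  unfold trigSeries
  rw [← (summable_mul_exp ha θ).tsum_add (summable_mul_exp hb θ)]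
  exact tsum_congr fun k => by rw [Pi.add_apply, add_mul]

theorem trigSeries_sub {a b : ℤ → ℂ} (ha : Summable fun k => ‖a k‖)
    (hb : Summable fun k => ‖b k‖) (θ : ℝ) :
    trigSeries (a - b) θ = trigSeries a θ - trigSeries b θ := by
  unfold trigSeries
  rw [← (summable_mul_exp ha θ).tsum_sub (summable_mul_exp hb θ)]
  exact tsum_congr fun k => by rw [Pi.sub_apply, sub_mul]

theorem trigSeries_delta (θ : ℝ) : trigSeries delta θ = 1 := by
  unfold trigSeries delta
  rw [tsum_eq_single 0]
  · simp
  · intro k hk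
    simp [hk]

theorem summable_norm_delta : Summable fun k => ‖delta k‖ :=
  summable_of_ne_finset_zero (s := {0}) fun k hk => by
    simp only [Finset.mem_singleton] at hk
    simp [delta, hk]

theorem continuous_trigSeries {a : ℤ → ℂ} (ha : Summable fun k => ‖a k‖) :
    Continuous (trigSeries a) :=
  continuous_tsum (fun k => by fun_prop) ha fun k θ => (norm_mul_exp_int a k θ).le

/-! ### Recovering the coefficients from the trigonometric series. -/

theorem integral_exp_int (n : ℤ) :
    ∫ θ in (-Real.pi)..Real.pi, Complex.exp (n * θ * Complex.I) =
      if n = 0 then (2 * Real.pi : ℂ) else 0 := by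
  split_ifs with h
  · subst h
    simp
    ring
  · have hc : (n : ℂ) * Complex.I ≠ 0 := by
      simp [h]
    have h1 : ∀ θ : ℝ, Complex.exp (n * θ * Complex.I) = Complex.exp (n * Complex.I * θ) := by
      intro θ
      ring_nf
    simp_rw [h1]
    rw [integral_exp_mul_complex hc, div_eq_zero_iff]
    left
    rw [sub_eq_zero, Complex.exp_eq_exp_iff_exists_int]
    exact ⟨n, by push_cast; ring⟩

theorem coeff_eq_integral {a : ℤ → ℂ} (ha : Summable fun k => ‖a k‖) (k : ℤ) :
    2 * Real.pi * a k =
      ∫ θ in (-Real.pi)..Real.pi, trigSeries a θ * Complex.exp (-(k * θ * Complex.I)) := by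
  have hF : ∀ (j : ℤ) (θ : ℝ), a j * Complex.exp (j * θ * Complex.I) *
      Complex.exp (-(k * θ * Complex.I)) = a j * Complex.exp ((j - k : ℤ) * θ * Complex.I) := by
    intro j θ
    rw [mul_assoc, ← Complex.exp_add]
    push_cast
    ring_nf
  have h := intervalIntegral.hasSum_integral_of_dominated_convergence (μ := volume)
    (a := -Real.pi) (b := Real.pi)
    (F := fun (j : ℤ) (θ : ℝ) => a j * Complex.exp ((j - k : ℤ) * θ * Complex.I))
    (f := fun θ => trigSeries a θ * Complex.exp (-(k * θ * Complex.I)))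
    (fun j _ => ‖a j‖)
    (fun j => by
      apply Continuous.aestronglyMeasurable
      fun_prop)
    (fun j => ae_of_all _ fun θ _ => by rw [norm_mul, norm_exp_int_mul, mul_one])
    (ae_of_all _ fun θ _ => ha)
    (by simp)
    (ae_of_all _ fun θ _ => by
      simp_rw [← hF]
      exact (summable_mul_exp ha θ).hasSum.mul_right _)
  rw [← h.tsum_eq, tsum_eq_single k]
  · rw [intervalIntegral.integral_const_mul, integral_exp_int]
    simp
    ring
  · intro j hj
    rw [intervalIntegral.integral_const_mul, integral_exp_int, if_neg (sub_ne_zero.mpr hj),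
      mul_zero]

theorem trigSeries_injective {a b : ℤ → ℂ} (ha : Summable fun k => ‖a k‖)
    (hb : Summable fun k => ‖b k‖) (h : ∀ θ, trigSeries a θ = trigSeries b θ) : a = b := by
  funext k
  have h2 : (2 * Real.pi : ℂ) ≠ 0 := by simp [Real.pi_ne_zero]
  apply mul_left_cancel₀ h2
  rw [coeff_eq_integral ha, coeff_eq_integral hb]
  simp_rw [h]

theorem summable_norm_lp (f : lp (fun _ : ℤ => ℂ) 1) : Summable fun k => ‖f k‖ := by
  simpa using (memℓp_gen_iff (by simp)).mp f.2

theorem norm_lp_eq_tsum (f : lp (fun _ : ℤ => ℂ) 1) : ‖f‖ = ∑' k, ‖f k‖ := by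
  simpa using lp.norm_eq_tsum_rpow (p := 1) (by simp) f

/-! ### The normed ring structure on ℓ¹(ℤ). -/

/-- The convolution algebra `ℓ¹(ℤ)`. -/
def Ell1 : Type := lp (fun _ : ℤ => ℂ) 1

namespace Ell1

noncomputable instance : NormedAddCommGroup Ell1 :=
  inferInstanceAs (NormedAddCommGroup (lp (fun _ : ℤ => ℂ) 1))

/-- The coefficients of an element of `ℓ¹(ℤ)`. -/
def coe (a : Ell1) : ℤ → ℂ := a.1

/-- An absolutely summable sequence, as an element of `ℓ¹(ℤ)`. -/
def mk (a : ℤ → ℂ) (ha : Summable fun k => ‖a k‖) : Ell1 :=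
  (⟨a, (memℓp_gen_iff (by simp)).mpr (by simpa using ha)⟩ : lp (fun _ : ℤ => ℂ) 1)

theorem coe_mk (a : ℤ → ℂ) (ha : Summable fun k => ‖a k‖) : (mk a ha).coe = a := rfl

theorem ext {a b : Ell1} (h : a.coe = b.coe) : a = b := Subtype.ext h

theorem summable (a : Ell1) : Summable fun k => ‖a.coe k‖ := summable_norm_lp a

theorem norm_eq (a : Ell1) : ‖a‖ = ∑' k, ‖a.coe k‖ := norm_lp_eq_tsum a

noncomputable instance : Mul Ell1 := ⟨fun a b => mk (conv a.coe b.coe)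
  (summable_norm_conv a.summable b.summable)⟩

noncomputable instance : One Ell1 := ⟨mk delta summable_norm_delta⟩

theorem coe_mul (a b : Ell1) : (a * b).coe = conv a.coe b.coe := rfl
theorem coe_one : (1 : Ell1).coe = delta := rfl
theorem coe_add (a b : Ell1) : (a + b).coe = a.coe + b.coe := rfl
theorem coe_sub (a b : Ell1) : (a - b).coe = a.coe - b.coe := rfl
theorem coe_zero : (0 : Ell1).coe = 0 := rfl

theorem ext_trigSeries {a b : Ell1} (h : ∀ θ, trigSeries a.coe θ = trigSeries b.coe θ) : a = b :=
  ext (trigSeries_injective a.summable b.summable h)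

theorem trigSeries_mul (a b : Ell1) (θ : ℝ) :
    trigSeries (a * b).coe θ = trigSeries a.coe θ * trigSeries b.coe θ :=
  trigSeries_conv a.summable b.summable θ

theorem trigSeries_add (a b : Ell1) (θ : ℝ) :
    trigSeries (a + b).coe θ = trigSeries a.coe θ + trigSeries b.coe θ :=
  RittSCM.trigSeries_add a.summable b.summable θ

theorem trigSeries_sub (a b : Ell1) (θ : ℝ) :
    trigSeries (a - b).coe θ = trigSeries a.coe θ - trigSeries b.coe θ :=
  RittSCM.trigSeries_sub a.summable b.summable θ

theorem trigSeries_one (θ : ℝ) : trigSeries (1 : Ell1).coe θ = 1 := trigSeries_delta θ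

theorem trigSeries_zero (θ : ℝ) : trigSeries (0 : Ell1).coe θ = 0 := by
  simp [coe_zero, trigSeries]

/-- The trigonometric series turns convolution into a pointwise product and determines the
coefficients, so each ring axiom reduces to the same axiom in ℂ. -/
noncomputable instance : NormedCommRing Ell1 where
  left_distrib a b c := ext_trigSeries fun θ => by
    simp only [trigSeries_mul, trigSeries_add, mul_add]
  right_distrib a b c := ext_trigSeries fun θ => by
    simp only [trigSeries_mul, trigSeries_add, add_mul]
  zero_mul a := ext_trigSeries fun θ => by simp only [trigSeries_mul, trigSeries_zero, zero_mul]
  mul_zero a := ext_trigSeries fun θ => by simp only [trigSeries_mul, trigSeries_zero, mul_zero]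
  mul_assoc a b c := ext_trigSeries fun θ => by simp only [trigSeries_mul, mul_assoc]
  one_mul a := ext_trigSeries fun θ => by simp only [trigSeries_mul, trigSeries_one, one_mul]
  mul_one a := ext_trigSeries fun θ => by simp only [trigSeries_mul, trigSeries_one, mul_one]
  mul_comm a b := ext_trigSeries fun θ => by simp only [trigSeries_mul, mul_comm]
  dist_eq a b := NormedAddCommGroup.dist_eq a b
  norm_mul_le a b := by
    rw [norm_eq, norm_eq, norm_eq]
    exact tsum_norm_conv_le a.summable b.summable

theorem coe_pow (a : Ell1) (n : ℕ) : (a ^ n).coe = convPow a.coe n := by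
  induction n with
  | zero => rw [pow_zero]; rfl
  | succ n ih => rw [pow_succ', coe_mul, ih]; rfl

theorem trigSeries_pow (a : Ell1) (n : ℕ) (θ : ℝ) :
    trigSeries (a ^ n).coe θ = trigSeries a.coe θ ^ n := by
  induction n with
  | zero => rw [pow_zero, pow_zero, trigSeries_one]
  | succ n ih => rw [pow_succ, pow_succ, trigSeries_mul, ih]

theorem norm_coe_le (a : Ell1) (k : ℤ) : ‖a.coe k‖ ≤ ‖a‖ := by
  rw [norm_eq]
  exact a.summable.le_tsum k fun _ _ => norm_nonneg _

theorem enorm_eq (a : Ell1) : ∑' k, ‖a.coe k‖ₑ = ENNReal.ofReal ‖a‖ := by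
  rw [norm_eq, ENNReal.ofReal_tsum_of_nonneg (fun _ => norm_nonneg _) a.summable]
  simp_rw [ofReal_norm]

end Ell1

/-! ### The symbol of an SCM measure -/

/-- `|1 - t e^{iθ}|²` as a function of `t` and `y = 1 - cos θ`. -/
def quadDenom (t y : ℝ) : ℝ := (1 - t) ^ 2 + 2 * t * y

/-- For t ≤ 1/2 the term (1 - t)² is at least 1/4; for t ≥ 1/2 the term 2ty is at least y. This
bound, uniform in t, justifies differentiation under the integral away from y = 0. -/
theorem min_le_quadDenom {t y : ℝ} (ht : t ∈ Set.Icc (0 : ℝ) 1) (hy : 0 ≤ y) :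
    min (1 / 4) y ≤ quadDenom t y := by
  unfold quadDenom
  rcases le_total t (1 / 2) with h | h
  · refine (min_le_left _ _).trans ?_
    nlinarith [mul_nonneg ht.1 hy]
  · refine (min_le_right _ _).trans ?_
    nlinarith [mul_nonneg (sub_nonneg.mpr h) hy, sq_nonneg (1 - t)]

theorem quadDenom_pos {t y : ℝ} (ht : t ∈ Set.Icc (0 : ℝ) 1) (hy : 0 < y) :
    0 < quadDenom t y :=
  (lt_min (by norm_num) hy).trans_le (min_le_quadDenom ht hy.le)

theorem hasDerivAt_div_quadDenom_pow (c t : ℝ) (m : ℕ) {y : ℝ} (h : 0 < quadDenom t y) :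
    HasDerivAt (fun y => c / quadDenom t y ^ m) (-(m * (2 * t) * c) / quadDenom t y ^ (m + 1)) y := by
  have h1 : HasDerivAt (quadDenom t) (2 * t) y := by
    have h := ((hasDerivAt_id y).const_mul (2 * t)).const_add ((1 - t) ^ 2)
    rw [mul_one] at h
    exact h
  have h2 := ((h1.pow m).fun_inv (pow_pos h m).ne').const_mul c
  refine h2.congr_deriv ?_
  rcases m with _ | m
  · simp
  · have := h.ne'
    simp only [Nat.add_sub_cancel, Pi.pow_apply]
    field_simp
    ring

variable {ν : Measure (Set.Icc (0 : ℝ) 1)}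

theorem measurable_div_quadDenom_pow {g : ℝ → ℝ} (hg : Continuous g) (m : ℕ) (y : ℝ) :
    Measurable fun t : Set.Icc (0 : ℝ) 1 => g t / quadDenom t y ^ m := by
  unfold quadDenom
  have := hg.measurable
  fun_prop

theorem norm_div_quadDenom_pow_le {g : ℝ → ℝ} {M y c : ℝ} (hM : ∀ t ∈ Set.Icc (0 : ℝ) 1, |g t| ≤ M)
    (m : ℕ) (hc : 0 < c) (hcy : c ≤ y) (hc4 : c ≤ 1 / 4) (t : Set.Icc (0 : ℝ) 1) :
    ‖g t / quadDenom t y ^ m‖ ≤ M / c ^ m := by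
  have h1 : c ≤ quadDenom t y := (le_min hc4 hcy).trans (min_le_quadDenom t.2 (hc.le.trans hcy))
  have h0 : 0 < quadDenom t y := hc.trans_le h1
  rw [Real.norm_eq_abs, abs_div, abs_of_pos (pow_pos h0 m)]
  have := hM t t.2
  gcongr
  exact (abs_nonneg _).trans this

theorem integrable_div_quadDenom_pow [IsFiniteMeasure ν] {g : ℝ → ℝ} (hg : Continuous g) (m : ℕ)
    {y : ℝ} (hy : 0 < y) :
    Integrable (fun t : Set.Icc (0 : ℝ) 1 => g t / quadDenom t y ^ m) ν := by
  obtain ⟨M, hM⟩ := isCompact_Icc.exists_bound_of_continuousOn (hg.continuousOn (s := Set.Icc 0 1))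
  exact Integrable.of_bound (measurable_div_quadDenom_pow hg m y).aestronglyMeasurable
    (M / (min (1 / 4) y) ^ m) (ae_of_all _ (norm_div_quadDenom_pow_le hM m
      (lt_min (by norm_num) hy) (min_le_right _ _) (min_le_left _ _)))

/-- Domination holds on the half-line above y/2. A general numerator and exponent let one statement
serve ψ and its derivatives (m = 1, 2, 3). -/
theorem hasDerivAt_integral_div_quadDenom_pow [IsFiniteMeasure ν] {g : ℝ → ℝ} (hg : Continuous g)
    (m : ℕ) {y : ℝ} (hy : 0 < y) :
    HasDerivAt (fun y => ∫ t : Set.Icc (0 : ℝ) 1, g t / quadDenom t y ^ m ∂ν)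
      (∫ t : Set.Icc (0 : ℝ) 1, -(m * (2 * t) * g t) / quadDenom t y ^ (m + 1) ∂ν) y := by
  have hg' : Continuous fun t : ℝ => -(m * (2 * t) * g t) := by fun_prop
  obtain ⟨M, hM⟩ := isCompact_Icc.exists_bound_of_continuousOn
    (hg'.continuousOn (s := Set.Icc 0 1))
  have hy2 : 0 < y / 2 := by positivity
  refine (hasDerivAt_integral_of_dominated_loc_of_deriv_le
    (F := fun y (t : Set.Icc (0 : ℝ) 1) => g t / quadDenom t y ^ m)
    (F' := fun y (t : Set.Icc (0 : ℝ) 1) => -(m * (2 * t) * g t) / quadDenom t y ^ (m + 1))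
    (bound := fun _ => M / (min (1 / 4) (y / 2)) ^ (m + 1))
    (Ioi_mem_nhds (half_lt_self hy))
    (.of_forall fun z => (measurable_div_quadDenom_pow hg m z).aestronglyMeasurable)
    (integrable_div_quadDenom_pow hg m hy)
    (measurable_div_quadDenom_pow hg' (m + 1) y).aestronglyMeasurable
    (ae_of_all _ fun t z hz => ?_) (integrable_const _) (ae_of_all _ fun t z hz => ?_)).2
  · exact norm_div_quadDenom_pow_le hM (m + 1) (lt_min (by norm_num) hy2)
      ((min_le_right _ _).trans (Set.mem_Ioi.mp hz).le) (min_le_left _ _) t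
  · exact hasDerivAt_div_quadDenom_pow _ _ _ (quadDenom_pos t.2 (hy2.trans hz))

/-- `∫ (1 + (1 - t²) / |1 - t e^{iθ}|²) ν(dt)` as a function of `y = 1 - cos θ`. -/
noncomputable def symbol (ν : Measure (Set.Icc (0 : ℝ) 1)) (y : ℝ) : ℝ :=
  ∫ t : Set.Icc (0 : ℝ) 1, (1 + (1 - (t : ℝ) ^ 2) / quadDenom t y) ∂ν

/-- Minus the derivative of `symbol`. -/
noncomputable def symbolDeriv (ν : Measure (Set.Icc (0 : ℝ) 1)) (y : ℝ) : ℝ :=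
  ∫ t : Set.Icc (0 : ℝ) 1, (2 * t * (1 - (t : ℝ) ^ 2)) / quadDenom t y ^ 2 ∂ν

/-- The second derivative of `symbol`. -/
noncomputable def symbolDeriv₂ (ν : Measure (Set.Icc (0 : ℝ) 1)) (y : ℝ) : ℝ :=
  ∫ t : Set.Icc (0 : ℝ) 1, (8 * t ^ 2 * (1 - (t : ℝ) ^ 2)) / quadDenom t y ^ 3 ∂ν

theorem hasDerivAt_symbol [IsFiniteMeasure ν] {y : ℝ} (hy : 0 < y) :
    HasDerivAt (symbol ν) (-symbolDeriv ν y) y := by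
  have h := hasDerivAt_integral_div_quadDenom_pow (ν := ν) (g := fun t => 1 - t ^ 2)
    (by fun_prop) 1 hy
  have h1 : symbol ν =ᶠ[nhds y] fun y => ν.real Set.univ +
      ∫ t : Set.Icc (0 : ℝ) 1, (1 - (t : ℝ) ^ 2) / quadDenom t y ^ 1 ∂ν := by
    filter_upwards [Ioi_mem_nhds hy] with z hz
    unfold symbol
    have hi := integrable_div_quadDenom_pow (ν := ν) (g := fun t => 1 - t ^ 2) (by fun_prop) 1 hz
    simp only [pow_one] at hi ⊢
    rw [integral_add (integrable_const _) hi]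
    simp
  refine ((h.const_add _).congr_of_eventuallyEq h1).congr_deriv ?_
  rw [symbolDeriv, ← integral_neg]
  refine integral_congr_ae (ae_of_all _ fun t => ?_)
  simp only [Nat.cast_one]
  ring

theorem hasDerivAt_symbolDeriv [IsFiniteMeasure ν] {y : ℝ} (hy : 0 < y) :
    HasDerivAt (symbolDeriv ν) (-symbolDeriv₂ ν y) y := by
  have h := hasDerivAt_integral_div_quadDenom_pow (ν := ν) (g := fun t => 2 * t * (1 - t ^ 2))
    (by fun_prop) 2 hy
  refine h.congr_deriv ?_
  rw [symbolDeriv₂, ← integral_neg]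
  refine integral_congr_ae (ae_of_all _ fun t => ?_)
  simp only [Nat.cast_ofNat]
  ring

theorem continuousAt_symbolDeriv₂ [IsFiniteMeasure ν] {y : ℝ} (hy : 0 < y) :
    ContinuousAt (symbolDeriv₂ ν) y :=
  (hasDerivAt_integral_div_quadDenom_pow (ν := ν) (g := fun t => 8 * t ^ 2 * (1 - t ^ 2))
    (by fun_prop) 3 hy).continuousAt

theorem one_sub_sq_nonneg (t : Set.Icc (0 : ℝ) 1) : 0 ≤ 1 - (t : ℝ) ^ 2 := by
  have := t.2.1
  have := t.2.2
  nlinarith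

theorem symbolDeriv_nonneg {y : ℝ} (hy : 0 < y) : 0 ≤ symbolDeriv ν y :=
  integral_nonneg fun t => by
    have := quadDenom_pos t.2 hy
    have := one_sub_sq_nonneg t
    have := t.2.1
    simp only [Pi.zero_apply]
    positivity

theorem symbolDeriv₂_nonneg {y : ℝ} (hy : 0 < y) : 0 ≤ symbolDeriv₂ ν y :=
  integral_nonneg fun t => by
    have := quadDenom_pos t.2 hy
    have := one_sub_sq_nonneg t
    have := t.2.1
    simp only [Pi.zero_apply]
    positivity

theorem two_mul_le_quadDenom (t y : ℝ) : 2 * t * y ≤ quadDenom t y := by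
  unfold quadDenom
  nlinarith [sq_nonneg (1 - t)]

/-- The inequality holds under the integral: the factor 2ty is absorbed by one power of the
denominator. -/
theorem mul_symbolDeriv₂_le [IsFiniteMeasure ν] {y : ℝ} (hy : 0 < y) :
    y * symbolDeriv₂ ν y ≤ 2 * symbolDeriv ν y := by
  unfold symbolDeriv symbolDeriv₂
  rw [← integral_const_mul, ← integral_const_mul]
  refine integral_mono
    ((integrable_div_quadDenom_pow (g := fun t => 8 * t ^ 2 * (1 - t ^ 2)) (by fun_prop) 3
      hy).const_mul _)
    ((integrable_div_quadDenom_pow (g := fun t => 2 * t * (1 - t ^ 2)) (by fun_prop) 2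
      hy).const_mul _) fun t => ?_
  have hQ := quadDenom_pos t.2 hy
  have h1 := one_sub_sq_nonneg t
  have ht := t.2.1
  have h2 := two_mul_le_quadDenom t y
  have e1 : y * (8 * (t : ℝ) ^ 2 * (1 - (t : ℝ) ^ 2) / quadDenom t y ^ 3) =
      (4 * t * (1 - (t : ℝ) ^ 2)) * (2 * t * y) / quadDenom t y ^ 3 := by ring
  have e2 : 2 * (2 * (t : ℝ) * (1 - (t : ℝ) ^ 2) / quadDenom t y ^ 2) =
      (4 * t * (1 - (t : ℝ) ^ 2)) * quadDenom t y / quadDenom t y ^ 3 := by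
    field_simp
    ring
  simp only [e1, e2]
  gcongr

theorem symbol_nonneg {y : ℝ} (hy : 0 ≤ y) : 0 ≤ symbol ν y :=
  integral_nonneg fun t => by
    have h0 : 0 ≤ quadDenom t y := by
      have := t.2.1
      unfold quadDenom
      positivity
    have := one_sub_sq_nonneg t
    simp only [Pi.zero_apply]
    positivity

section Normalized

variable [IsFiniteMeasure ν] (hint : Integrable (fun t : Set.Icc (0 : ℝ) 1 => (1 - (t : ℝ))⁻¹) ν)
  (hval : ∫ t : Set.Icc (0 : ℝ) 1, (1 - (t : ℝ))⁻¹ ∂ν = 1 / 2)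
  (hone : ∀ᵐ t : Set.Icc (0 : ℝ) 1 ∂ν, (t : ℝ) < 1)

include hint hval hone

/-- The normalisation writes 1 as ∫ 2/(1 - t) dν. With Q the denominator, the integrand of 1 - ψ
becomes 2ty(1 + t)/((1 - t)Q), and that of the left side is the same times (1 - t)²/Q ≤ 1. -/
theorem mul_symbolDeriv_le {y : ℝ} (hy : 0 < y) : y * symbolDeriv ν y ≤ 1 - symbol ν y := by
  have hi := integrable_div_quadDenom_pow (ν := ν) (g := fun t => 1 - t ^ 2) (by fun_prop) 1 hy
  simp_rw [pow_one] at hi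
  have h1 : 1 - symbol ν y = ∫ t : Set.Icc (0 : ℝ) 1,
      (2 * (1 - (t : ℝ))⁻¹ - (1 + (1 - (t : ℝ) ^ 2) / quadDenom t y)) ∂ν := by
    have h2 : Integrable (fun t : Set.Icc (0 : ℝ) 1 => 1 + (1 - (t : ℝ) ^ 2) / quadDenom t y) ν :=
      (integrable_const _).add hi
    rw [integral_sub (hint.const_mul 2) h2, integral_const_mul, hval, symbol]
    norm_num
  rw [h1, symbolDeriv, ← integral_const_mul]
  refine integral_mono_ae
    ((integrable_div_quadDenom_pow (g := fun t => 2 * t * (1 - t ^ 2)) (by fun_prop) 2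
      hy).const_mul _) ((hint.const_mul 2).sub ((integrable_const _).add hi)) ?_
  filter_upwards [hone] with t ht1
  have hQ := quadDenom_pos t.2 hy
  have ht := t.2.1
  have hs : 0 < 1 - (t : ℝ) := by linarith
  have e1 : 2 * (1 - (t : ℝ))⁻¹ - (1 + (1 - (t : ℝ) ^ 2) / quadDenom t y) =
      (2 * t * y * (1 + t)) * quadDenom t y / ((1 - (t : ℝ)) * quadDenom t y ^ 2) := by
    field_simp
    unfold quadDenom
    ring
  have e2 : y * (2 * (t : ℝ) * (1 - (t : ℝ) ^ 2) / quadDenom t y ^ 2) =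
      (2 * t * y * (1 + t)) * (1 - t) ^ 2 / ((1 - (t : ℝ)) * quadDenom t y ^ 2) := by
    field_simp
    ring
  simp only [e1, e2]
  gcongr
  unfold quadDenom
  have : 0 ≤ 2 * t * y := by positivity
  linarith

theorem symbol_le_one {y : ℝ} (hy : 0 < y) : symbol ν y ≤ 1 := by
  have := mul_symbolDeriv_le hint hval hone hy
  have := mul_nonneg hy.le (symbolDeriv_nonneg (ν := ν) hy)
  linarith

end Normalized

/-! ### A Pólya type criterion for absolutely convergent cosine series -/

/-- The Fourier series of the Bernoulli polynomial B₂ gives the full sum πθ/2 - θ²/4. The terms are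
nonnegative, so partial sums are smaller; the k = 0 term is 0. -/
theorem sum_one_sub_cos_div_sq_le {θ : ℝ} (h0 : 0 ≤ θ) (h1 : θ ≤ Real.pi) (s : Finset ℕ) :
    ∑ k ∈ s, (1 - Real.cos (k * θ)) / (k : ℝ) ^ 2 ≤ Real.pi / 2 * θ := by
  have hpi := Real.pi_pos
  have hx : θ / (2 * Real.pi) ∈ Set.Icc (0 : ℝ) 1 :=
    ⟨by positivity, by rw [div_le_one (by positivity)]; linarith⟩
  have h := (hasSum_zeta_two.sub (hasSum_one_div_nat_pow_mul_cos one_ne_zero hx))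
  have hb : (Polynomial.map (algebraMap ℚ ℝ) (Polynomial.bernoulli 2)).eval (θ / (2 * Real.pi)) =
      (θ / (2 * Real.pi)) ^ 2 - θ / (2 * Real.pi) + 1 / 6 := by
    simp [Polynomial.bernoulli, Finset.sum_range_succ, bernoulli_two, bernoulli_one]
    ring
  have hs : ∀ k : ℕ, 1 / (k : ℝ) ^ 2 - 1 / (k : ℝ) ^ (2 * 1) *
      Real.cos (2 * Real.pi * k * (θ / (2 * Real.pi))) = (1 - Real.cos (k * θ)) / (k : ℝ) ^ 2 := by
    intro k
    have : 2 * Real.pi * k * (θ / (2 * Real.pi)) = k * θ := by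
      field_simp
    rw [this]
    ring
  simp_rw [hs] at h
  refine (sum_le_hasSum s (fun k _ => ?_) h).trans ?_
  · have := Real.cos_le_one (k * θ)
    exact div_nonneg (by linarith) (by positivity)
  · rw [mul_one, hb]
    norm_num [Nat.factorial]
    have e : Real.pi ^ 2 / 6 - (2 * Real.pi) ^ 2 / 2 / 2 *
        ((θ / (2 * Real.pi)) ^ 2 - θ / (2 * Real.pi) + 1 / 6) =
        Real.pi / 2 * θ - θ ^ 2 / 4 := by
      field_simp
      ring
    nlinarith [sq_nonneg θ]

variable {φ φ₁ φ₂ : ℝ → ℝ}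

/-- Two integrations by parts. Taking (1 - cos kθ)/k² as the antiderivative of sin(kθ)/k, rather
than -cos(kθ)/k², makes the boundary term at ε small even if φ' blows up at 0, and leaves a
nonnegative weight. -/
theorem integral_mul_cos_eq {ε : ℝ} (hε : 0 < ε) (hεπ : ε ≤ Real.pi)
    (h1 : ∀ θ, 0 < θ → θ ≤ Real.pi → HasDerivAt φ (φ₁ θ) θ)
    (h2 : ∀ θ, 0 < θ → θ ≤ Real.pi → HasDerivAt φ₁ (φ₂ θ) θ)
    (hc : ContinuousOn φ₂ (Set.Ioc 0 Real.pi)) (hπ : φ₁ Real.pi = 0) {k : ℕ} (hk : 1 ≤ k) :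
    ∫ θ in ε..Real.pi, φ θ * Real.cos (k * θ) =
      -(φ ε * Real.sin (k * ε) / k) + φ₁ ε * (1 - Real.cos (k * ε)) / (k : ℝ) ^ 2 +
        ∫ θ in ε..Real.pi, φ₂ θ * ((1 - Real.cos (k * θ)) / (k : ℝ) ^ 2) := by
  have hk0 : (k : ℝ) ≠ 0 := by positivity
  have hI : Set.uIcc ε Real.pi ⊆ Set.Ioc 0 Real.pi := by
    rw [Set.uIcc_of_le hεπ]
    exact fun θ hθ => ⟨hε.trans_le hθ.1, hθ.2⟩
  have hφ : ContinuousOn φ (Set.uIcc ε Real.pi) := fun θ hθ =>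
    (h1 θ (hI hθ).1 (hI hθ).2).continuousAt.continuousWithinAt
  have i1 : IntervalIntegrable (fun θ => φ θ * Real.cos (k * θ)) volume ε Real.pi :=
    (hφ.mul (by fun_prop)).intervalIntegrable
  have i2 : IntervalIntegrable (fun θ => φ₂ θ * ((1 - Real.cos (k * θ)) / (k : ℝ) ^ 2))
      volume ε Real.pi :=
    ((hc.mono hI).mul (by fun_prop)).intervalIntegrable
  have hd : ∀ θ ∈ Set.uIcc ε Real.pi,
      HasDerivAt (fun θ => φ θ * (Real.sin (k * θ) / k) -
        φ₁ θ * ((1 - Real.cos (k * θ)) / (k : ℝ) ^ 2))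
        (φ θ * Real.cos (k * θ) - φ₂ θ * ((1 - Real.cos (k * θ)) / (k : ℝ) ^ 2)) θ := by
    intro θ hθ
    have hkθ : HasDerivAt (fun θ : ℝ => k * θ) k θ := by
      simpa using (hasDerivAt_id θ).const_mul (k : ℝ)
    have d1 := (h1 θ (hI hθ).1 (hI hθ).2).mul (hkθ.sin.div_const (k : ℝ))
    have d2 := (h2 θ (hI hθ).1 (hI hθ).2).mul ((hkθ.cos.const_sub 1).div_const ((k : ℝ) ^ 2))
    refine (d1.sub d2).congr_deriv ?_
    field_simp
    ring
  have hF := intervalIntegral.integral_eq_sub_of_hasDerivAt hd (i1.sub i2)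
  rw [intervalIntegral.integral_sub i1 i2, Real.sin_nat_mul_pi, hπ] at hF
  rw [eq_add_of_sub_eq hF]
  ring

/-- The weights (1 - cos kθ)/k² are summed over k inside the integral, which costs only (π/2)θ. For
fixed K the boundary terms at ε are at most K(|φ(ε)|ε + ε²|φ'(ε)|) and vanish as ε → 0. -/
theorem sum_abs_integral_mul_cos_le (hφ : Continuous φ)
    (h1 : ∀ θ, 0 < θ → θ ≤ Real.pi → HasDerivAt φ (φ₁ θ) θ)
    (h2 : ∀ θ, 0 < θ → θ ≤ Real.pi → HasDerivAt φ₁ (φ₂ θ) θ)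
    (hc : ContinuousOn φ₂ (Set.Ioc 0 Real.pi)) (hπ : φ₁ Real.pi = 0)
    (hz : Filter.Tendsto (fun ε => ε ^ 2 * |φ₁ ε|) (nhdsWithin 0 (Set.Ioi 0)) (nhds 0))
    {A : ℝ} (hA : ∀ ε, 0 < ε → ε ≤ Real.pi → ∫ θ in ε..Real.pi, θ * |φ₂ θ| ≤ A) (K : ℕ) :
    ∑ k ∈ Finset.Icc 1 K, |∫ θ in (0 : ℝ)..Real.pi, φ θ * Real.cos (k * θ)| ≤
      Real.pi / 2 * A := by
  have hpi := Real.pi_pos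
  have hlim : Filter.Tendsto (fun ε => ∑ k ∈ Finset.Icc 1 K,
      |∫ θ in ε..Real.pi, φ θ * Real.cos (k * θ)|) (nhdsWithin 0 (Set.Ioi 0))
      (nhds (∑ k ∈ Finset.Icc 1 K, |∫ θ in (0 : ℝ)..Real.pi, φ θ * Real.cos (k * θ)|)) := by
    refine tendsto_finsetSum _ fun k _ => ?_
    have hcont : Continuous fun θ => φ θ * Real.cos (k * θ) := by fun_prop
    have : Continuous fun ε => ∫ θ in ε..Real.pi, φ θ * Real.cos (k * θ) := by
      simp_rw [intervalIntegral.integral_symm Real.pi]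
      exact (intervalIntegral.continuous_primitive
        (fun a b => hcont.intervalIntegrable a b) _).neg
    exact ((this.abs).tendsto 0).mono_left nhdsWithin_le_nhds
  have hlim2 : Filter.Tendsto (fun ε => K * (|φ ε| * ε + ε ^ 2 * |φ₁ ε|) + Real.pi / 2 * A)
      (nhdsWithin 0 (Set.Ioi 0)) (nhds (K * (|φ 0| * 0 + 0) + Real.pi / 2 * A)) := by
    have : Filter.Tendsto (fun ε => |φ ε| * ε) (nhdsWithin 0 (Set.Ioi 0)) (nhds (|φ 0| * 0)) :=
      ((hφ.abs.mul continuous_id).tendsto 0).mono_left nhdsWithin_le_nhds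
    exact ((this.add hz).const_mul _).add_const _
  simp only [mul_zero, add_zero, zero_add] at hlim2
  refine le_of_tendsto_of_tendsto hlim hlim2 ?_
  filter_upwards [Ioc_mem_nhdsGT hpi] with ε hε
  have hI : Set.uIcc ε Real.pi ⊆ Set.Ioc 0 Real.pi := by
    rw [Set.uIcc_of_le hε.2]
    exact fun θ hθ => ⟨hε.1.trans_le hθ.1, hθ.2⟩
  have hc2 := hc.mono hI
  have hw : ∀ (k : ℕ) (θ : ℝ), 0 ≤ (1 - Real.cos (k * θ)) / (k : ℝ) ^ 2 := fun k θ => by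
    have := Real.cos_le_one (k * θ)
    exact div_nonneg (by linarith) (by positivity)
  have hi : ∀ k : ℕ, IntervalIntegrable
      (fun θ => |φ₂ θ| * ((1 - Real.cos (k * θ)) / (k : ℝ) ^ 2)) volume ε Real.pi := fun k =>
    (hc2.abs.mul (by fun_prop)).intervalIntegrable
  have hterm : ∀ k ∈ Finset.Icc 1 K, |∫ θ in ε..Real.pi, φ θ * Real.cos (k * θ)| ≤
      (|φ ε| * ε + ε ^ 2 * |φ₁ ε|) +
        ∫ θ in ε..Real.pi, |φ₂ θ| * ((1 - Real.cos (k * θ)) / (k : ℝ) ^ 2) := by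
    intro k hk
    have hk1 := (Finset.mem_Icc.mp hk).1
    have hk0 : (0 : ℝ) < k := by positivity
    rw [integral_mul_cos_eq hε.1 hε.2 h1 h2 hc hπ hk1]
    refine (abs_add_le _ _).trans (add_le_add ((abs_add_le _ _).trans (add_le_add ?_ ?_)) ?_)
    · rw [abs_neg, abs_div, abs_mul, abs_of_pos hk0, mul_div_assoc]
      refine mul_le_mul_of_nonneg_left ?_ (abs_nonneg _)
      rw [div_le_iff₀ hk0]
      calc |Real.sin (k * ε)| ≤ |k * ε| := Real.abs_sin_le_abs
        _ = ε * k := by rw [abs_of_pos (mul_pos hk0 hε.1), mul_comm]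
    · have h3 : (1 - Real.cos (k * ε)) / (k : ℝ) ^ 2 ≤ ε ^ 2 := by
        rw [div_le_iff₀ (by positivity)]
        have := Real.one_sub_sq_div_two_le_cos (x := k * ε)
        nlinarith [sq_nonneg (k * ε)]
      rw [mul_div_assoc, abs_mul, abs_of_nonneg (hw k ε), mul_comm]
      exact mul_le_mul_of_nonneg_right h3 (abs_nonneg _)
    · refine (intervalIntegral.abs_integral_le_integral_abs hε.2).trans_eq ?_
      refine intervalIntegral.integral_congr fun θ _ => ?_
      simp only [abs_mul, abs_of_nonneg (hw k θ)]
  refine (Finset.sum_le_sum hterm).trans ?_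
  rw [Finset.sum_add_distrib, Finset.sum_const, Nat.card_Icc, Nat.add_sub_cancel, nsmul_eq_mul,
    ← intervalIntegral.integral_finsetSum fun k _ => hi k]
  refine add_le_add le_rfl ?_
  calc _ ≤ ∫ θ in ε..Real.pi, Real.pi / 2 * (θ * |φ₂ θ|) := by
        refine intervalIntegral.integral_mono_on hε.2 ?_ ?_ fun θ hθ => ?_
        · exact (ContinuousOn.intervalIntegrable (by fun_prop))
        · exact (ContinuousOn.intervalIntegrable (by fun_prop))
        · rw [← Finset.mul_sum]
          have := sum_one_sub_cos_div_sq_le (hε.1.le.trans hθ.1) hθ.2 (Finset.Icc 1 K)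
          have h4 := mul_le_mul_of_nonneg_left this (abs_nonneg (φ₂ θ))
          linarith
    _ ≤ _ := by
        rw [intervalIntegral.integral_const_mul]
        exact mul_le_mul_of_nonneg_left (hA ε hε.1 hε.2) (by positivity)

theorem pi_mul_coeff_eq_integral {a : ℤ → ℂ} (ha : Summable fun k => ‖a k‖) {φ : ℝ → ℝ}
    (hφ : ∀ θ, trigSeries a θ = φ θ) (heven : ∀ θ, φ (-θ) = φ θ) (k : ℤ) :
    Real.pi * a k = ((∫ θ in (0 : ℝ)..Real.pi, φ θ * Real.cos (k * θ) : ℝ) : ℂ) := by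
  have hc : Continuous fun θ : ℝ => (φ θ : ℂ) := by
    simp_rw [← hφ]
    exact continuous_trigSeries ha
  have hi : ∀ (j : ℤ) (x y : ℝ), IntervalIntegrable
      (fun θ : ℝ => (φ θ : ℂ) * Complex.exp (-(j * θ * Complex.I))) volume x y := fun j x y =>
    Continuous.intervalIntegrable (by fun_prop) x y
  have h := coeff_eq_integral ha k
  simp_rw [hφ] at h
  rw [← intervalIntegral.integral_add_adjacent_intervals (hi k (-Real.pi) 0) (hi k 0 Real.pi)] at h
  have h1 := intervalIntegral.integral_comp_neg (a := 0) (b := Real.pi)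
    (fun θ : ℝ => (φ θ : ℂ) * Complex.exp (-(k * θ * Complex.I)))
  rw [neg_zero] at h1
  have h2 : ∀ θ : ℝ, (φ (-θ) : ℂ) * Complex.exp (-(k * ((-θ : ℝ) : ℂ) * Complex.I)) =
      (φ θ : ℂ) * Complex.exp (-((-k : ℤ) * θ * Complex.I)) := by
    intro θ
    rw [heven]
    push_cast
    ring_nf
  simp_rw [h2] at h1
  rw [← h1, ← intervalIntegral.integral_add (hi _ _ _) (hi _ _ _)] at h
  have h3 : ∀ θ : ℝ, (φ θ : ℂ) * Complex.exp (-((-k : ℤ) * θ * Complex.I)) +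
      (φ θ : ℂ) * Complex.exp (-(k * θ * Complex.I)) =
      2 * ((φ θ * Real.cos (k * θ) : ℝ) : ℂ) := by
    intro θ
    push_cast
    rw [Complex.cos]
    ring_nf
  simp_rw [h3] at h
  rw [intervalIntegral.integral_const_mul, intervalIntegral.integral_ofReal, mul_assoc] at h
  exact mul_left_cancel₀ two_ne_zero h

/-! ### The Ritt property -/

/-- The left side is one term of the binomial expansion of (u + (1 - u))^(N + j) = 1. -/
theorem choose_mul_pow_mul_pow_le_one {u : ℝ} (h0 : 0 ≤ u) (h1 : u ≤ 1) (N j : ℕ) :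
    ((N + j).choose N : ℝ) * (u ^ N * (1 - u) ^ j) ≤ 1 := by
  have h := add_pow u (1 - u) (N + j)
  rw [add_sub_cancel, one_pow] at h
  have h2 := Finset.single_le_sum
    (f := fun m => u ^ m * (1 - u) ^ (N + j - m) * ((N + j).choose m : ℝ))
    (fun m _ => by have := sub_nonneg.mpr h1; positivity)
    (Finset.mem_range.mpr (Nat.lt_succ_of_le (Nat.le_add_right N j)))
  rw [← h, Nat.add_sub_cancel_left] at h2
  linarith

theorem succ_mul_pow_le {u : ℝ} (h0 : 0 ≤ u) (h1 : u ≤ 1) (N : ℕ) :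
    ((N : ℝ) + 1) * (u ^ N * (1 - u)) ≤ 1 := by
  simpa [Nat.choose_succ_self_right] using choose_mul_pow_mul_pow_le_one h0 h1 N 1

theorem succ_mul_pow_sq_le {u : ℝ} (h0 : 0 ≤ u) (h1 : u ≤ 1) (N : ℕ) :
    ((N : ℝ) + 1) * (N + 2) * (u ^ N * (1 - u) ^ 2) ≤ 2 := by
  have h := choose_mul_pow_mul_pow_le_one h0 h1 N 2
  have e : (((N + 2).choose N : ℕ) : ℝ) = (N + 1) * (N + 2) / 2 := by
    rw [Nat.choose_symm_add, Nat.cast_choose_two]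
    push_cast
    ring
  rw [e] at h
  linarith

theorem succ_mul_pow_cube_le {u : ℝ} (h0 : 0 ≤ u) (h1 : u ≤ 1) (N : ℕ) :
    ((N : ℝ) + 1) * (N + 2) * (N + 3) * (u ^ N * (1 - u) ^ 3) ≤ 6 := by
  have h := choose_mul_pow_mul_pow_le_one h0 h1 N 3
  have e : (((N + 3).choose N : ℕ) : ℝ) * 6 = (N + 1) * (N + 2) * (N + 3) := by
    have h3 := Nat.descFactorial_eq_factorial_mul_choose (N + 3) 3
    rw [Nat.choose_symm_add]
    simp [Nat.descFactorial, Nat.factorial] at h3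
    have h4 : (((N + 3).choose 3 * 6 : ℕ) : ℝ) = (((N + 1) * (N + 2) * (N + 3) : ℕ) : ℝ) := by
      congr 1
      linarith
    exact_mod_cast h4
  rw [← e]
  linarith

/-! ### The polynomial u^(N+2) - u^(N+3) and its majorant. -/

/-- The first derivative of `u ↦ u ^ (N + 2) - u ^ (N + 3)`. -/
def gapDeriv (N : ℕ) (u : ℝ) : ℝ := u ^ (N + 1) * ((N + 3) * (1 - u) - 1)

/-- The second derivative of `u ↦ u ^ (N + 2) - u ^ (N + 3)`. -/
def gapDeriv₂ (N : ℕ) (u : ℝ) : ℝ := (N + 2) * u ^ N * ((N + 3) * (1 - u) - 2)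

/-- A polynomial that dominates `2 (1 - u) |P''| + 5 |P'|` for `P = u ^ (N + 2) - u ^ (N + 3)`. -/
def gapMajorant (N : ℕ) (u : ℝ) : ℝ :=
  2 * (N + 2) * (u ^ N * ((N + 3) * (1 - u) ^ 2 + 2 * (1 - u))) +
    5 * (u ^ (N + 1) * ((N + 3) * (1 - u) + 1))

theorem hasDerivAt_gap (N : ℕ) (u : ℝ) :
    HasDerivAt (fun u : ℝ => u ^ (N + 2) - u ^ (N + 3)) (gapDeriv N u) u := by
  refine ((hasDerivAt_pow (N + 2) u).sub (hasDerivAt_pow (N + 3) u)).congr_deriv ?_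
  simp only [gapDeriv, Nat.cast_add, Nat.cast_ofNat,
    show N + 2 - 1 = N + 1 by omega, show N + 3 - 1 = N + 2 by omega]
  ring

theorem hasDerivAt_gapDeriv (N : ℕ) (u : ℝ) : HasDerivAt (gapDeriv N) (gapDeriv₂ N u) u := by
  have h1 := (hasDerivAt_pow (N + 1) u).mul
    ((((hasDerivAt_id u).const_sub 1).const_mul ((N : ℝ) + 3)).sub_const 1)
  refine h1.congr_deriv ?_
  simp only [gapDeriv₂, Nat.add_sub_cancel, Nat.cast_add, Nat.cast_one, id_eq]
  ring

theorem continuous_gapMajorant (N : ℕ) : Continuous (gapMajorant N) := by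
  unfold gapMajorant
  fun_prop

theorem gapMajorant_nonneg (N : ℕ) {u : ℝ} (h0 : 0 ≤ u) (h1 : u ≤ 1) : 0 ≤ gapMajorant N u := by
  have := sub_nonneg.mpr h1
  unfold gapMajorant
  positivity

theorem abs_gapDeriv_le_gapMajorant (N : ℕ) {u : ℝ} (h0 : 0 ≤ u) (h1 : u ≤ 1) :
    2 * (1 - u) * |gapDeriv₂ N u| + 5 * |gapDeriv N u| ≤ gapMajorant N u := by
  have hu := sub_nonneg.mpr h1
  have e1 : |gapDeriv N u| ≤ u ^ (N + 1) * ((N + 3) * (1 - u) + 1) := by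
    rw [gapDeriv, abs_mul, abs_of_nonneg (by positivity : 0 ≤ u ^ (N + 1))]
    refine mul_le_mul_of_nonneg_left (abs_le.mpr ⟨?_, by linarith⟩) (by positivity)
    have : 0 ≤ ((N : ℝ) + 3) * (1 - u) := by positivity
    linarith
  have e2 : |gapDeriv₂ N u| ≤ (N + 2) * u ^ N * ((N + 3) * (1 - u) + 2) := by
    rw [gapDeriv₂, abs_mul, abs_of_nonneg (by positivity : 0 ≤ ((N : ℝ) + 2) * u ^ N)]
    refine mul_le_mul_of_nonneg_left (abs_le.mpr ⟨?_, by linarith⟩) (by positivity)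
    have : 0 ≤ ((N : ℝ) + 3) * (1 - u) := by positivity
    linarith
  calc _ ≤ 2 * (1 - u) * ((N + 2) * u ^ N * ((N + 3) * (1 - u) + 2)) +
        5 * (u ^ (N + 1) * ((N + 3) * (1 - u) + 1)) := by gcongr
    _ = _ := by unfold gapMajorant; ring

/-- The integral equals 18/(N + 1) - 10/((N + 1)(N + 2)). -/
theorem integral_gapMajorant_le (N : ℕ) : ∫ u in (0 : ℝ)..1, gapMajorant N u ≤ 18 / (N + 1) := by
  have e : ∀ u : ℝ, gapMajorant N u =
      2 * (N + 2) * (N + 5) * u ^ N - (4 * (N + 2) * (N + 4) - 5 * (N + 4)) * u ^ (N + 1) +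
        (2 * (N + 2) * (N + 3) - 5 * (N + 3)) * u ^ (N + 2) := by
    intro u
    unfold gapMajorant
    ring
  have hi : ∀ (c : ℝ) (m : ℕ), IntervalIntegrable (fun u : ℝ => c * u ^ m) volume 0 1 :=
    fun c m => Continuous.intervalIntegrable (by fun_prop) _ _
  simp_rw [e]
  rw [intervalIntegral.integral_add ((hi _ _).sub (hi _ _)) (hi _ _),
    intervalIntegral.integral_sub (hi _ _) (hi _ _)]
  simp only [intervalIntegral.integral_const_mul, integral_pow]
  have h1 : (0 : ℝ) < N + 1 := by positivity
  have h2 : (0 : ℝ) < N + 2 := by positivity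
  have h3 : (0 : ℝ) < N + 3 := by positivity
  rw [← sub_nonneg]
  have : 18 / ((N : ℝ) + 1) - (2 * (N + 2) * (N + 5) * ((1 ^ (N + 1) - 0 ^ (N + 1)) / (N + 1)) -
      (4 * (N + 2) * (N + 4) - 5 * (N + 4)) * ((1 ^ (N + 1 + 1) - 0 ^ (N + 1 + 1)) / ((N + 1 : ℕ) + 1)) +
      (2 * (N + 2) * (N + 3) - 5 * (N + 3)) * ((1 ^ (N + 2 + 1) - 0 ^ (N + 2 + 1)) / ((N + 2 : ℕ) + 1)))
      = 10 / ((N + 1) * (N + 2)) := by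
    push_cast
    simp only [one_pow, ne_eq, Nat.add_eq_zero_iff, one_ne_zero, and_false, not_false_eq_true,
      zero_pow, sub_zero]
    rw [show (N : ℝ) + 1 + 1 = N + 2 by ring, show (N : ℝ) + 2 + 1 = N + 3 by ring]
    field_simp
    ring
  rw [this]
  positivity

/-- After multiplication by N + 1 the four terms are bounded by the binomial estimates: 40 = 2·6 +
4·2 + 5·3 + 5·1. -/
theorem one_sub_mul_gapMajorant_le (N : ℕ) {u : ℝ} (h0 : 0 ≤ u) (h1 : u ≤ 1) :
    (1 - u) * gapMajorant N u ≤ 40 / (N + 1) := by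
  have hu := sub_nonneg.mpr h1
  rw [le_div_iff₀ (by positivity)]
  have a1 := succ_mul_pow_le h0 h1 N
  have a2 := succ_mul_pow_sq_le h0 h1 N
  have a3 := succ_mul_pow_cube_le h0 h1 N
  have b1 : ((N : ℝ) + 1) * (u ^ (N + 1) * (1 - u)) ≤ 1 := by
    refine le_trans ?_ a1
    gcongr ((N : ℝ) + 1) * (?_ * (1 - u))
    exact pow_le_pow_of_le_one h0 h1 (Nat.le_succ N)
  have b2 : ((N : ℝ) + 1) * (N + 3) * (u ^ (N + 1) * (1 - u) ^ 2) ≤ 3 := by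
    have c1 : u ^ (N + 1) * (1 - u) ^ 2 ≤ u ^ N * (1 - u) ^ 2 := by
      gcongr ?_ * (1 - u) ^ 2
      exact pow_le_pow_of_le_one h0 h1 (Nat.le_succ N)
    have c2 : 0 ≤ u ^ N * (1 - u) ^ 2 := by positivity
    have c3 : 0 ≤ ((N : ℝ) + 1) * N * (u ^ N * (1 - u) ^ 2) := by positivity
    have c4 : ((N : ℝ) + 1) * (N + 3) * (u ^ (N + 1) * (1 - u) ^ 2) ≤
      ((N : ℝ) + 1) * (N + 3) * (u ^ N * (1 - u) ^ 2) := by gcongr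
    nlinarith
  have e : (1 - u) * gapMajorant N u * (N + 1) =
      2 * (((N : ℝ) + 1) * (N + 2) * (N + 3) * (u ^ N * (1 - u) ^ 3)) +
      4 * (((N : ℝ) + 1) * (N + 2) * (u ^ N * (1 - u) ^ 2)) +
      5 * (((N : ℝ) + 1) * (N + 3) * (u ^ (N + 1) * (1 - u) ^ 2)) +
      5 * (((N : ℝ) + 1) * (u ^ (N + 1) * (1 - u))) := by
    unfold gapMajorant
    ring
  rw [e]
  linarith

theorem norm_le_of_even {a : Ell1} (hneg : ∀ i : ℕ, ‖a.coe (-((i : ℤ) + 1))‖ =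
    ‖a.coe ((i + 1 : ℕ) : ℤ)‖) {A B : ℝ} (hzero : ‖a.coe 0‖ ≤ A)
    (hsum : ∀ K : ℕ, ∑ i ∈ Finset.range K, ‖a.coe ((i + 1 : ℕ) : ℤ)‖ ≤ B) :
    ‖a‖ ≤ A + 2 * B := by
  have hs1 : Summable fun i : ℕ => ‖a.coe ((i + 1 : ℕ) : ℤ)‖ :=
    summable_of_sum_range_le (fun _ => norm_nonneg _) hsum
  have hs0 : Summable fun i : ℕ => ‖a.coe (i : ℤ)‖ :=
    a.summable.comp_injective Nat.cast_injective
  have hs2 : Summable fun i : ℕ => ‖a.coe (-((i : ℤ) + 1))‖ := hs1.congr fun i => (hneg i).symm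
  have ht := Real.tsum_le_of_sum_range_le (fun _ => norm_nonneg _) hsum
  have h := tsum_of_nat_of_neg_add_one (f := fun k => ‖a.coe k‖) hs0 hs2
  rw [Ell1.norm_eq, h, hs0.tsum_eq_zero_add, tsum_congr hneg, Nat.cast_zero]
  linarith

/-! ### The ℓ¹ estimate for p^(N+2)(1 - p). -/

section Symbol

variable {ν : Measure (Set.Icc (0 : ℝ) 1)} [IsFiniteMeasure ν]

theorem one_sub_cos_pos {θ : ℝ} (h0 : 0 < θ) (hπ : θ ≤ Real.pi) : 0 < 1 - Real.cos θ := by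
  have := Real.cos_lt_cos_of_nonneg_of_le_pi le_rfl hπ h0
  rw [Real.cos_zero] at this
  linarith

theorem hasDerivAt_one_sub_cos (θ : ℝ) :
    HasDerivAt (fun θ => 1 - Real.cos θ) (Real.sin θ) θ := by
  simpa using (Real.hasDerivAt_cos θ).const_sub 1

theorem hasDerivAt_symbol_one_sub_cos {θ : ℝ} (h0 : 0 < θ) (hπ : θ ≤ Real.pi) :
    HasDerivAt (fun θ => symbol ν (1 - Real.cos θ))
      (-(symbolDeriv ν (1 - Real.cos θ) * Real.sin θ)) θ :=
  ((hasDerivAt_symbol (ν := ν) (one_sub_cos_pos h0 hπ)).comp (h := fun θ => 1 - Real.cos θ) θ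
    (hasDerivAt_one_sub_cos θ)).congr_deriv (neg_mul _ _)

theorem hasDerivAt_symbolDeriv_mul_sin {θ : ℝ} (h0 : 0 < θ) (hπ : θ ≤ Real.pi) :
    HasDerivAt (fun θ => symbolDeriv ν (1 - Real.cos θ) * Real.sin θ)
      (-(symbolDeriv₂ ν (1 - Real.cos θ) * Real.sin θ ^ 2) +
        symbolDeriv ν (1 - Real.cos θ) * Real.cos θ) θ :=
by
  have h : HasDerivAt (fun θ => symbolDeriv ν (1 - Real.cos θ))
      (-symbolDeriv₂ ν (1 - Real.cos θ) * Real.sin θ) θ :=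
    (hasDerivAt_symbolDeriv (ν := ν) (one_sub_cos_pos h0 hπ)).comp (h := fun θ => 1 - Real.cos θ) θ
      (hasDerivAt_one_sub_cos θ)
  exact (h.mul (Real.hasDerivAt_sin θ)).congr_deriv (by ring)

/-- The second derivative of `θ ↦ u ^ (N + 2) - u ^ (N + 3)` for `u = symbol ν (1 - cos θ)`. -/
noncomputable def symbolGapDeriv₂ (ν : Measure (Set.Icc (0 : ℝ) 1)) (N : ℕ) (θ : ℝ) : ℝ :=
  gapDeriv₂ N (symbol ν (1 - Real.cos θ)) * (symbolDeriv ν (1 - Real.cos θ) * Real.sin θ) ^ 2 -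
    gapDeriv N (symbol ν (1 - Real.cos θ)) * (-(symbolDeriv₂ ν (1 - Real.cos θ) * Real.sin θ ^ 2) +
        symbolDeriv ν (1 - Real.cos θ) * Real.cos θ)

theorem continuousOn_symbolGapDeriv₂ (N : ℕ) :
    ContinuousOn (symbolGapDeriv₂ ν N) (Set.Ioc 0 Real.pi) := by
  intro θ hθ
  apply ContinuousAt.continuousWithinAt
  have hy := one_sub_cos_pos hθ.1 hθ.2
  have hcos : ContinuousAt (fun θ => 1 - Real.cos θ) θ := by fun_prop
  have c0 : ContinuousAt (fun θ => symbol ν (1 - Real.cos θ)) θ :=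
    (hasDerivAt_symbol_one_sub_cos hθ.1 hθ.2).continuousAt
  have c1 : ContinuousAt (fun θ => symbolDeriv ν (1 - Real.cos θ)) θ :=
    ContinuousAt.comp (f := fun θ => 1 - Real.cos θ) (hasDerivAt_symbolDeriv hy).continuousAt hcos
  have c2 : ContinuousAt (fun θ => symbolDeriv₂ ν (1 - Real.cos θ)) θ :=
    ContinuousAt.comp (f := fun θ => 1 - Real.cos θ) (continuousAt_symbolDeriv₂ hy) hcos
  unfold symbolGapDeriv₂ gapDeriv gapDeriv₂
  fun_prop

variable (hint : Integrable (fun t : Set.Icc (0 : ℝ) 1 => (1 - (t : ℝ))⁻¹) ν)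
  (hval : ∫ t : Set.Icc (0 : ℝ) 1, (1 - (t : ℝ))⁻¹ ∂ν = 1 / 2)
  (hone : ∀ᵐ t : Set.Icc (0 : ℝ) 1 ∂ν, (t : ℝ) < 1)

include hint hval hone

/-- Write y = 1 - cos θ, u = ψ(y), d = -ψ'(y). Since sin²θ ≤ 2y, the bound yd ≤ 1 - u gives (d sin
θ)² ≤ 2(1 - u)d, and yψ'' ≤ 2d gives ψ'' sin²θ + d|cos θ| ≤ 5d. These are the weights 2(1 - u) and 5
built into `gapMajorant`. -/
theorem abs_symbolGapDeriv₂_le (N : ℕ) {θ : ℝ} (h0 : 0 < θ) (hπ : θ ≤ Real.pi) :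
    |symbolGapDeriv₂ ν N θ| ≤
      symbolDeriv ν (1 - Real.cos θ) * gapMajorant N (symbol ν (1 - Real.cos θ)) := by
  have hy := one_sub_cos_pos h0 hπ
  have hsin : Real.sin θ ^ 2 ≤ 2 * (1 - Real.cos θ) := by
    nlinarith [Real.sin_sq_add_cos_sq θ, sq_nonneg (1 - Real.cos θ)]
  have hcos := Real.abs_cos_le_one θ
  have hS := mul_symbolDeriv_le hint hval hone hy
  have hS2 := mul_symbolDeriv₂_le (ν := ν) hy
  have hu0 := symbol_nonneg (ν := ν) hy.le
  have hu1 := symbol_le_one hint hval hone hy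
  have hD := symbolDeriv_nonneg (ν := ν) hy
  have hD2 := symbolDeriv₂_nonneg (ν := ν) hy
  unfold symbolGapDeriv₂
  generalize symbol ν (1 - Real.cos θ) = u at *
  generalize symbolDeriv ν (1 - Real.cos θ) = d at *
  generalize symbolDeriv₂ ν (1 - Real.cos θ) = d2 at *
  refine le_trans ?_ (mul_le_mul_of_nonneg_left (abs_gapDeriv_le_gapMajorant N hu0 hu1) hD)
  refine (abs_sub _ _).trans ?_
  rw [abs_mul, abs_mul, abs_of_nonneg (sq_nonneg (d * Real.sin θ))]
  have e1 : (d * Real.sin θ) ^ 2 ≤ d * (2 * (1 - u)) := by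
    have : d * (d * Real.sin θ ^ 2) ≤ d * (2 * (1 - u)) := by
      refine mul_le_mul_of_nonneg_left ?_ hD
      have := mul_le_mul_of_nonneg_left hsin hD
      linarith
    linarith
  have e2 : |(-(d2 * Real.sin θ ^ 2) + d * Real.cos θ)| ≤ d * 5 := by
    refine (abs_add_le _ _).trans ?_
    rw [abs_neg, abs_of_nonneg (mul_nonneg hD2 (sq_nonneg _)), abs_mul, abs_of_nonneg hD]
    have i1 := mul_le_mul_of_nonneg_left hsin hD2
    have i2 := mul_le_mul_of_nonneg_left hcos hD
    linarith
  have f1 := mul_le_mul_of_nonneg_left e1 (abs_nonneg (gapDeriv₂ N u))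
  have f2 := mul_le_mul_of_nonneg_left e2 (abs_nonneg (gapDeriv N u))
  linarith

/-- On the first half of the range θ is comparable to sin θ, and d sin θ dθ = -du turns the integral
into that of `gapMajorant` over part of [0, 1]. The other half contributes at most a uniform bound
times its length. -/
theorem integral_mul_abs_symbolGapDeriv₂_le (N : ℕ) {ε : ℝ} (hε : 0 < ε) (hεπ : ε ≤ Real.pi) :
    ∫ θ in ε..Real.pi, θ * |symbolGapDeriv₂ ν N θ| ≤ 50 * Real.pi ^ 2 / (N + 1) := by
  have hpi := Real.pi_pos
  have hI : Set.uIcc ε Real.pi ⊆ Set.Ioc 0 Real.pi := by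
    rw [Set.uIcc_of_le hεπ]
    exact fun θ hθ => ⟨hε.trans_le hθ.1, hθ.2⟩
  have hcd : ContinuousOn (fun θ => -(symbolDeriv ν (1 - Real.cos θ) * Real.sin θ))
      (Set.uIcc ε Real.pi) := fun θ hθ =>
    (hasDerivAt_symbolDeriv_mul_sin (hI hθ).1 (hI hθ).2).continuousAt.neg.continuousWithinAt
  have hcu : ContinuousOn (fun θ => symbol ν (1 - Real.cos θ)) (Set.uIcc ε Real.pi) :=
    fun θ hθ => (hasDerivAt_symbol_one_sub_cos (hI hθ).1 (hI hθ).2).continuousAt.continuousWithinAt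
  have hsub := intervalIntegral.integral_comp_mul_deriv
    (fun θ hθ => hasDerivAt_symbol_one_sub_cos (ν := ν) (hI hθ).1 (hI hθ).2) hcd
    (continuous_gapMajorant N)
  have hbd : ∀ θ, 0 < θ → θ ≤ Real.pi →
      0 ≤ symbol ν (1 - Real.cos θ) ∧ symbol ν (1 - Real.cos θ) ≤ 1 := fun θ h0 h1 =>
    ⟨symbol_nonneg (one_sub_cos_pos h0 h1).le,
      symbol_le_one hint hval hone (one_sub_cos_pos h0 h1)⟩
  have hicm : IntervalIntegrable (fun θ => (gapMajorant N ∘ fun θ => symbol ν (1 - Real.cos θ)) θ *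
      -(symbolDeriv ν (1 - Real.cos θ) * Real.sin θ)) volume ε Real.pi :=
    ContinuousOn.intervalIntegrable
      (((continuous_gapMajorant N).comp_continuousOn hcu).mul hcd)
  have hle : symbol ν (1 - Real.cos Real.pi) ≤ symbol ν (1 - Real.cos ε) := by
    have hneg : ∫ θ in ε..Real.pi, -(symbolDeriv ν (1 - Real.cos θ) * Real.sin θ) ≤ 0 := by
      rw [intervalIntegral.integral_neg, neg_nonpos]
      refine intervalIntegral.integral_nonneg hεπ fun θ hθ => ?_
      exact mul_nonneg (symbolDeriv_nonneg (one_sub_cos_pos (hε.trans_le hθ.1) hθ.2))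
        (Real.sin_nonneg_of_nonneg_of_le_pi (hε.le.trans hθ.1) hθ.2)
    rw [intervalIntegral.integral_eq_sub_of_hasDerivAt
      (fun θ hθ => hasDerivAt_symbol_one_sub_cos (ν := ν) (hI hθ).1 (hI hθ).2)
      hcd.intervalIntegrable] at hneg
    linarith
  have hmaj : ∫ u in symbol ν (1 - Real.cos Real.pi)..symbol ν (1 - Real.cos ε), gapMajorant N u ≤
      18 / (N + 1) := by
    refine le_trans ?_ (integral_gapMajorant_le N)
    refine intervalIntegral.integral_mono_interval (hbd _ hpi le_rfl).1 hle (hbd _ hε hεπ).2 ?_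
      ((continuous_gapMajorant N).intervalIntegrable _ _)
    filter_upwards [ae_restrict_mem measurableSet_Ioc] with u hu
    exact gapMajorant_nonneg N hu.1.le hu.2
  calc ∫ θ in ε..Real.pi, θ * |symbolGapDeriv₂ ν N θ|
      ≤ ∫ θ in ε..Real.pi, (-(Real.pi / 2) * ((gapMajorant N ∘
          fun θ => symbol ν (1 - Real.cos θ)) θ *
          -(symbolDeriv ν (1 - Real.cos θ) * Real.sin θ)) + Real.pi * (40 / (N + 1))) := by
        refine intervalIntegral.integral_mono_on hεπ ?_ ((hicm.const_mul _).add (by simp))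
          fun θ hθ => ?_
        · exact (continuousOn_id.mul
            ((continuousOn_symbolGapDeriv₂ N).mono hI).abs).intervalIntegrable
        · have h0 : 0 < θ := hε.trans_le hθ.1
          have hy := one_sub_cos_pos h0 hθ.2
          have h1 := abs_symbolGapDeriv₂_le hint hval hone N h0 hθ.2
          have hS := mul_symbolDeriv_le hint hval hone hy
          have hD := symbolDeriv_nonneg (ν := ν) hy
          have hm := gapMajorant_nonneg N (hbd θ h0 hθ.2).1 (hbd θ h0 hθ.2).2
          have hm2 := one_sub_mul_gapMajorant_le N (hbd θ h0 hθ.2).1 (hbd θ h0 hθ.2).2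
          have hsin := Real.sin_nonneg_of_nonneg_of_le_pi h0.le hθ.2
          simp only [Function.comp_apply]
          rw [show ∀ x y z : ℝ, -(Real.pi / 2) * (x * -(y * z)) = Real.pi / 2 * z * (y * x) by
            intros; ring]
          -- Near π the factor sin θ degenerates and cannot replace θ. There 1 - cos θ ≥ 1, so d ≤ 1
          -- - u and (1 - u) times the majorant is O(1/N) pointwise.
          rcases le_total θ (Real.pi / 2) with h2 | h2
          · have h3 := Real.mul_le_sin h0.le h2
            have h4 : θ ≤ Real.pi / 2 * Real.sin θ := by
              have : Real.pi / 2 * (2 / Real.pi * θ) = θ := by field_simp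
              nlinarith
            have : 0 ≤ Real.pi * (40 / ((N : ℝ) + 1)) := by positivity
            have := mul_le_mul h4 h1 (abs_nonneg _) (by positivity)
            linarith
          · have hcos : Real.cos θ ≤ 0 :=
              Real.cos_nonpos_of_pi_div_two_le_of_le h2 (by linarith [hθ.2])
            have h5 : symbolDeriv ν (1 - Real.cos θ) ≤ 1 - symbol ν (1 - Real.cos θ) := by
              nlinarith
            have h6 := (h1.trans (mul_le_mul_of_nonneg_right h5 hm)).trans hm2
            have h7 := mul_le_mul hθ.2 h6 (abs_nonneg _) hpi.le
            have : 0 ≤ Real.pi / 2 * Real.sin θ * (symbolDeriv ν (1 - Real.cos θ) *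
              gapMajorant N (symbol ν (1 - Real.cos θ))) := by positivity
            linarith
    _ = Real.pi / 2 * (∫ u in symbol ν (1 - Real.cos Real.pi)..symbol ν (1 - Real.cos ε),
          gapMajorant N u) + (Real.pi - ε) * (Real.pi * (40 / (N + 1))) := by
        rw [intervalIntegral.integral_add (hicm.const_mul _) (by simp),
          intervalIntegral.integral_const_mul, hsub, intervalIntegral.integral_symm,
          intervalIntegral.integral_const, smul_eq_mul]
        ring
    _ ≤ Real.pi / 2 * (18 / (N + 1)) + Real.pi * (Real.pi * (40 / (N + 1))) := by
        gcongr
        linarith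
    _ ≤ 50 * Real.pi ^ 2 / (N + 1) := by
        rw [show Real.pi / 2 * (18 / ((N : ℝ) + 1)) + Real.pi * (Real.pi * (40 / (N + 1))) =
          (9 * Real.pi + 40 * Real.pi ^ 2) / (N + 1) by ring]
        gcongr
        nlinarith [Real.pi_gt_three]

/-- Since (2/π²)ε² ≤ 1 - cos ε, the bound yd ≤ 1 - u ≤ 1 keeps ε²d bounded, and the remaining factor
sin ε tends to 0. -/
theorem tendsto_sq_mul_gapDeriv (N : ℕ) :
    Filter.Tendsto (fun ε => ε ^ 2 * |gapDeriv N (symbol ν (1 - Real.cos ε)) *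
      -(symbolDeriv ν (1 - Real.cos ε) * Real.sin ε)|) (nhdsWithin 0 (Set.Ioi 0)) (nhds 0) := by
  have hlim : Filter.Tendsto (fun ε : ℝ => ((N : ℝ) + 4) * (Real.pi ^ 2 / 2) * Real.sin ε)
      (nhdsWithin 0 (Set.Ioi 0)) (nhds 0) := by
    have : Continuous fun ε : ℝ => ((N : ℝ) + 4) * (Real.pi ^ 2 / 2) * Real.sin ε := by fun_prop
    simpa using (this.tendsto 0).mono_left nhdsWithin_le_nhds
  refine squeeze_zero' (.of_forall fun ε => by positivity) ?_ hlim
  filter_upwards [Ioc_mem_nhdsGT Real.pi_pos] with ε hε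
  have hy := one_sub_cos_pos hε.1 hε.2
  have hu0 := symbol_nonneg (ν := ν) hy.le
  have hu1 := symbol_le_one hint hval hone hy
  have hD := symbolDeriv_nonneg (ν := ν) hy
  have hS := mul_symbolDeriv_le hint hval hone hy
  have hsin := Real.sin_nonneg_of_nonneg_of_le_pi hε.1.le hε.2
  have hcos := Real.cos_le_one_sub_mul_cos_sq (x := ε) (by rw [abs_of_pos hε.1]; exact hε.2)
  generalize symbol ν (1 - Real.cos ε) = u at *
  have hP : |gapDeriv N u| ≤ N + 4 := by
    rw [gapDeriv, abs_mul, abs_of_nonneg (by positivity : 0 ≤ u ^ (N + 1))]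
    have h1 : u ^ (N + 1) ≤ 1 := pow_le_one₀ hu0 hu1
    have h2 : |((N : ℝ) + 3) * (1 - u) - 1| ≤ N + 4 := by
      have i1 : ((N : ℝ) + 3) * (1 - u) ≤ N + 3 :=
        mul_le_of_le_one_right (by positivity) (by linarith)
      have i2 : 0 ≤ ((N : ℝ) + 3) * (1 - u) := mul_nonneg (by positivity) (by linarith)
      have i3 : (0 : ℝ) ≤ N := by positivity
      rw [abs_le]
      constructor <;> linarith
    calc _ ≤ 1 * ((N : ℝ) + 4) := by gcongr
      _ = _ := one_mul _
  have hd : ε ^ 2 * symbolDeriv ν (1 - Real.cos ε) ≤ Real.pi ^ 2 / 2 := by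
    have h1 : 2 / Real.pi ^ 2 * ε ^ 2 * symbolDeriv ν (1 - Real.cos ε) ≤ 1 :=
      (mul_le_mul_of_nonneg_right (by linarith) hD).trans (hS.trans (by linarith))
    have h2 : ε ^ 2 * symbolDeriv ν (1 - Real.cos ε) =
        Real.pi ^ 2 / 2 * (2 / Real.pi ^ 2 * ε ^ 2 * symbolDeriv ν (1 - Real.cos ε)) := by
      have := Real.pi_ne_zero
      field_simp
    rw [h2]
    exact mul_le_of_le_one_right (by positivity) h1
  rw [abs_mul, abs_neg, abs_mul, abs_of_nonneg hD, abs_of_nonneg hsin]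
  calc _ = |gapDeriv N u| * (ε ^ 2 * symbolDeriv ν (1 - Real.cos ε)) * Real.sin ε := by ring
    _ ≤ _ := by gcongr

theorem sum_abs_integral_symbolGap_le (N : ℕ)
    (hcont : Continuous fun θ =>
      symbol ν (1 - Real.cos θ) ^ (N + 2) - symbol ν (1 - Real.cos θ) ^ (N + 3)) (K : ℕ) :
    ∑ k ∈ Finset.Icc 1 K, |∫ θ in (0 : ℝ)..Real.pi,
      (symbol ν (1 - Real.cos θ) ^ (N + 2) - symbol ν (1 - Real.cos θ) ^ (N + 3)) *
        Real.cos (k * θ)| ≤ Real.pi / 2 * (50 * Real.pi ^ 2 / (N + 1)) := by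
  refine sum_abs_integral_mul_cos_le hcont
    (φ₁ := fun θ => gapDeriv N (symbol ν (1 - Real.cos θ)) *
      -(symbolDeriv ν (1 - Real.cos θ) * Real.sin θ)) (φ₂ := symbolGapDeriv₂ ν N)
    (fun θ h0 h1 => ?_) (fun θ h0 h1 => ?_) (continuousOn_symbolGapDeriv₂ N) (by simp)
    (tendsto_sq_mul_gapDeriv hint hval hone N)
    (fun ε h0 h1 => integral_mul_abs_symbolGapDeriv₂_le hint hval hone N h0 h1) K
  · exact (hasDerivAt_gap N _).comp (h := fun θ => symbol ν (1 - Real.cos θ)) θ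
      (hasDerivAt_symbol_one_sub_cos h0 h1)
  · have h2 : HasDerivAt (fun θ => gapDeriv N (symbol ν (1 - Real.cos θ)))
        (gapDeriv₂ N (symbol ν (1 - Real.cos θ)) *
          -(symbolDeriv ν (1 - Real.cos θ) * Real.sin θ)) θ :=
      (hasDerivAt_gapDeriv N _).comp (h := fun θ => symbol ν (1 - Real.cos θ)) θ
        (hasDerivAt_symbol_one_sub_cos h0 h1)
    refine (h2.mul (hasDerivAt_symbolDeriv_mul_sin (ν := ν) h0 h1).fun_neg).congr_deriv ?_
    unfold symbolGapDeriv₂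
    ring

theorem norm_pow_mul_one_sub_le {p : Ell1}
    (hp : ∀ θ, trigSeries p.coe θ = (symbol ν (1 - Real.cos θ) : ℝ)) (N : ℕ) :
    ‖p ^ (N + 2) * (1 - p)‖ ≤ (1 + 50 * Real.pi ^ 2) / (N + 1) := by
  have hpi := Real.pi_pos
  set a := p ^ (N + 2) * (1 - p) with ha
  set φ : ℝ → ℝ := fun θ =>
    symbol ν (1 - Real.cos θ) ^ (N + 2) - symbol ν (1 - Real.cos θ) ^ (N + 3) with hφdef
  have hφ : ∀ θ, trigSeries a.coe θ = φ θ := by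
    intro θ
    rw [ha, Ell1.trigSeries_mul, Ell1.trigSeries_pow, Ell1.trigSeries_sub, Ell1.trigSeries_one, hp,
      hφdef]
    push_cast
    ring
  -- The derivative formulas hold only for θ > 0; continuity at 0 comes from absolute convergence of
  -- the trigonometric series.
  have hcont : Continuous φ := by
    have h := Complex.continuous_re.comp (continuous_trigSeries a.summable)
    refine h.congr fun θ => ?_
    rw [Function.comp_apply, hφ, Complex.ofReal_re]
  have hcoef := pi_mul_coeff_eq_integral a.summable hφ fun θ => by simp only [hφdef, Real.cos_neg]
  have hnorm : ∀ k : ℤ, ‖a.coe k‖ =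
      Real.pi⁻¹ * |∫ θ in (0 : ℝ)..Real.pi, φ θ * Real.cos (k * θ)| := by
    intro k
    have h := congrArg norm (hcoef k)
    rw [norm_mul, Complex.norm_real, Complex.norm_real, Real.norm_eq_abs, Real.norm_eq_abs,
      abs_of_pos hpi] at h
    rw [← h, inv_mul_cancel_left₀ hpi.ne']
  have hsum : ∀ K : ℕ, ∑ i ∈ Finset.range K, ‖a.coe ((i + 1 : ℕ) : ℤ)‖ ≤
      25 * Real.pi ^ 2 / (N + 1) := by
    intro K
    have h := sum_abs_integral_symbolGap_le hint hval hone N hcont K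
    have e : Finset.Icc 1 K = Finset.Ico (0 + 1) (K + 1) := by
      ext
      simp [Finset.mem_Icc, Finset.mem_Ico]
    rw [e, ← Finset.sum_Ico_add', ← Finset.range_eq_Ico] at h
    simp_rw [hnorm, ← Finset.mul_sum, Int.cast_natCast]
    calc _ ≤ Real.pi⁻¹ * (Real.pi / 2 * (50 * Real.pi ^ 2 / (N + 1))) := by gcongr
      _ = _ := by
        field_simp
        norm_num
  -- The cosine criterion covers only k ≥ 1; the mean of φ is bounded by its supremum.
  have hzero : ‖a.coe 0‖ ≤ 1 / (N + 1) := by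
    have hb : ∀ θ ∈ Set.uIoc 0 Real.pi, ‖φ θ * Real.cos ((0 : ℤ) * θ)‖ ≤ 1 / (N + 1) := by
      intro θ hθ
      rw [Set.uIoc_of_le hpi.le] at hθ
      have hy := one_sub_cos_pos hθ.1 hθ.2
      have hu0 := symbol_nonneg (ν := ν) hy.le
      have hu1 := symbol_le_one hint hval hone hy
      simp only [hφdef, Int.cast_zero, zero_mul, Real.cos_zero, mul_one]
      generalize symbol ν (1 - Real.cos θ) = u at *
      have hu2 := sub_nonneg.mpr hu1
      have h1 := succ_mul_pow_le hu0 hu1 (N + 2)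
      push_cast at h1
      have e : u ^ (N + 2) - u ^ (N + 3) = u ^ (N + 2) * (1 - u) := by ring
      have hq : 0 ≤ u ^ (N + 2) * (1 - u) := by positivity
      rw [e, Real.norm_of_nonneg hq, le_div_iff₀ (by positivity)]
      nlinarith
    have h := intervalIntegral.norm_integral_le_of_norm_le_const hb
    rw [sub_zero, abs_of_pos hpi, Real.norm_eq_abs] at h
    rw [hnorm, inv_mul_le_iff₀ hpi, mul_comm Real.pi]
    exact h
  have hneg : ∀ i : ℕ, ‖a.coe (-((i : ℤ) + 1))‖ = ‖a.coe ((i + 1 : ℕ) : ℤ)‖ := by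
    intro i
    rw [hnorm, hnorm]
    congr 3
    funext θ
    push_cast
    rw [neg_mul, Real.cos_neg]
  refine (norm_le_of_even hneg hzero hsum).trans_eq ?_
  ring

end Symbol

/-! ### Fourier transform of an SCM measure -/

theorem hasSum_real_singleton (μ : Measure ℤ) [IsProbabilityMeasure μ] :
    HasSum (fun k : ℤ => μ.real {k}) 1 := by
  have h : ∑' k : ℤ, μ {k} = 1 := by
    have := lintegral_countable' (μ := μ) fun _ => 1
    simpa using this.symm
  have h1 : ∑' k : ℤ, μ {k} ≠ ∞ := by simp [h]
  have h2 := (ENNReal.summable_toReal h1).hasSum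
  rwa [← ENNReal.tsum_toReal_eq fun k => measure_ne_top μ _, h, ENNReal.toReal_one] at h2

theorem norm_weight (μ : Measure ℤ) (k : ℤ) : ‖weight μ k‖ = μ.real {k} := by
  rw [weight, Complex.norm_real, Real.norm_of_nonneg measureReal_nonneg]

theorem summable_norm_weight (μ : Measure ℤ) [IsProbabilityMeasure μ] :
    Summable fun k => ‖weight μ k‖ := by
  simp_rw [norm_weight]
  exact (hasSum_real_singleton μ).summable

/-- With z = te^{iθ}, this is 2 Re (1 - z)⁻¹ = 1 + (1 - |z|²)/|1 - z|². The n = 0 term is 2, in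
accordance with μ(0) = 2ν([0, 1]). -/
theorem hasSum_pow_mul_cos {t : ℝ} (h0 : 0 ≤ t) (h1 : t < 1) (θ : ℝ) :
    HasSum (fun n : ℕ => t ^ n * (2 * Real.cos (n * θ)))
      (1 + (1 - t ^ 2) / quadDenom t (1 - Real.cos θ)) := by
  set z : ℂ := t * Complex.exp (θ * Complex.I) with hz
  have hnz : ‖z‖ < 1 := by
    rw [hz, norm_mul, Complex.norm_exp_ofReal_mul_I, mul_one, Complex.norm_real,
      Real.norm_of_nonneg h0]
    exact h1
  have hre : z.re = t * Real.cos θ := by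
    rw [hz, Complex.re_ofReal_mul, Complex.exp_ofReal_mul_I_re]
  have him : z.im = t * Real.sin θ := by
    rw [hz, Complex.im_ofReal_mul, Complex.exp_ofReal_mul_I_im]
  have hterm : ∀ n : ℕ, t ^ n * (2 * Real.cos (n * θ)) = 2 * (z ^ n).re := by
    intro n
    rw [hz, mul_pow, ← Complex.exp_nat_mul, ← Complex.ofReal_pow, Complex.re_ofReal_mul]
    have : (n : ℂ) * (θ * Complex.I) = ((n * θ : ℝ) : ℂ) * Complex.I := by
      push_cast
      ring
    rw [this, Complex.exp_ofReal_mul_I_re]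
    ring
  have hns : Complex.normSq (1 - z) = quadDenom t (1 - Real.cos θ) := by
    rw [Complex.normSq_apply]
    simp only [Complex.sub_re, Complex.one_re, Complex.sub_im, Complex.one_im, hre, him, quadDenom]
    nlinarith [Real.sin_sq_add_cos_sq θ]
  have hpos : 0 < quadDenom t (1 - Real.cos θ) := by
    rw [← hns, Complex.normSq_pos, sub_ne_zero]
    rintro h
    rw [← h, norm_one] at hnz
    exact lt_irrefl _ hnz
  have h := (Complex.hasSum_re (hasSum_geometric_of_norm_lt_one hnz)).mul_left 2
  simp_rw [← hterm] at h
  convert! h using 1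
  rw [Complex.inv_re, hns, Complex.sub_re, Complex.one_re, hre]
  have := hpos.ne'
  field_simp
  unfold quadDenom
  ring

/-- The density of an SCM measure, with Bochner integrals. -/
theorem IsSCM.exists_density {μ : Measure ℤ} (h : IsSCM μ) :
    ∃ ν : Measure (Set.Icc (0 : ℝ) 1), IsFiniteMeasure ν ∧
      Integrable (fun t : Set.Icc (0 : ℝ) 1 => (1 - (t : ℝ))⁻¹) ν ∧
      ∫ t : Set.Icc (0 : ℝ) 1, (1 - (t : ℝ))⁻¹ ∂ν = 1 / 2 ∧
      (∀ᵐ t : Set.Icc (0 : ℝ) 1 ∂ν, (t : ℝ) < 1) ∧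
      μ.real {0} = 2 * ν.real Set.univ ∧
      ∀ n : ℕ, 1 ≤ n → μ.real {(n : ℤ)} = ∫ t : Set.Icc (0 : ℝ) 1, (t : ℝ) ^ n ∂ν := by
  obtain ⟨-, ν, hν, hhalf, hzero, hpow⟩ := h
  have hmeas : Measurable fun t : Set.Icc (0 : ℝ) 1 => (ENNReal.ofReal (1 - (t : ℝ)))⁻¹ := by
    fun_prop
  -- An atom of ν at 1 would make the integral of 1/(1 - t) infinite.
  have hone : ∀ᵐ t : Set.Icc (0 : ℝ) 1 ∂ν, (t : ℝ) < 1 := by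
    filter_upwards [ae_lt_top hmeas (by rw [hhalf]; simp)] with t ht
    rw [ENNReal.inv_lt_top, ENNReal.ofReal_pos] at ht
    linarith
  have hnn : ∀ t : Set.Icc (0 : ℝ) 1, 0 ≤ (1 - (t : ℝ))⁻¹ := fun t =>
    inv_nonneg.mpr (sub_nonneg.mpr t.2.2)
  have hasm : AEStronglyMeasurable (fun t : Set.Icc (0 : ℝ) 1 => (1 - (t : ℝ))⁻¹) ν :=
    Measurable.aestronglyMeasurable (by fun_prop)
  have hlin : ∫⁻ t : Set.Icc (0 : ℝ) 1, ENNReal.ofReal (1 - (t : ℝ))⁻¹ ∂ν = 1 / 2 := by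
    rw [← hhalf]
    refine lintegral_congr_ae ?_
    filter_upwards [hone] with t ht
    exact ENNReal.ofReal_inv_of_pos (sub_pos.mpr ht)
  refine ⟨ν, hν, ?_, ?_, hone, ?_, fun n hn => ?_⟩
  · exact (lintegral_ofReal_ne_top_iff_integrable hasm (ae_of_all _ hnn)).mp (by rw [hlin]; simp)
  · rw [integral_eq_lintegral_of_nonneg_ae (ae_of_all _ hnn) hasm, hlin]
    simp
  · rw [measureReal_def, hzero, lintegral_one, ENNReal.toReal_mul, measureReal_def]
    simp
  · rw [measureReal_def, hpow n hn, integral_eq_lintegral_of_nonneg_ae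
      (ae_of_all _ fun t => pow_nonneg t.2.1 n) (Measurable.aestronglyMeasurable (by fun_prop))]

theorem IsSCM.real_neg {μ : Measure ℤ} (h : IsSCM μ) (n : ℤ) : μ.real {-n} = μ.real {n} := by
  rw [measureReal_def, measureReal_def, h.1]

theorem integrable_pow_val {ν : Measure (Set.Icc (0 : ℝ) 1)} [IsFiniteMeasure ν] (n : ℕ) :
    Integrable (fun t : Set.Icc (0 : ℝ) 1 => (t : ℝ) ^ n) ν :=
  Integrable.of_bound (Measurable.aestronglyMeasurable (by fun_prop)) 1
    (ae_of_all _ fun t => by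
      rw [Real.norm_of_nonneg (pow_nonneg t.2.1 n)]
      exact pow_le_one₀ t.2.1 t.2.2)

theorem trigSeries_weight {μ : Measure ℤ} [IsProbabilityMeasure μ]
    (hsymm : ∀ n : ℤ, μ.real {-n} = μ.real {n}) {ν : Measure (Set.Icc (0 : ℝ) 1)}
    [IsFiniteMeasure ν] (hone : ∀ᵐ t : Set.Icc (0 : ℝ) 1 ∂ν, (t : ℝ) < 1)
    (hzero : μ.real {0} = 2 * ν.real Set.univ)
    (hpow : ∀ n : ℕ, 1 ≤ n → μ.real {(n : ℤ)} = ∫ t : Set.Icc (0 : ℝ) 1, (t : ℝ) ^ n ∂ν)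
    (θ : ℝ) : trigSeries (weight μ) θ = (symbol ν (1 - Real.cos θ) : ℝ) := by
  -- For n ≥ 1 the moments are the weights μ(n), hence summable; this permits exchanging the sum and
  -- the ν-integral.
  have hmom : Summable fun n : ℕ => ∫ t : Set.Icc (0 : ℝ) 1, (t : ℝ) ^ n ∂ν := by
    rw [← summable_nat_add_iff 1]
    have h1 : Summable fun n : ℕ => μ.real {((n + 1 : ℕ) : ℤ)} :=
      (hasSum_real_singleton μ).summable.comp_injective
        (i := fun n : ℕ => ((n + 1 : ℕ) : ℤ)) fun a b h => by simpa using h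
    exact h1.congr fun n => hpow (n + 1) (by omega)
  have hI : HasSum (fun n : ℕ => (∫ t : Set.Icc (0 : ℝ) 1, (t : ℝ) ^ n ∂ν) *
      (2 * Real.cos (n * θ))) (symbol ν (1 - Real.cos θ)) := by
    have h := hasSum_integral_of_summable_integral_norm (μ := ν)
      (F := fun (n : ℕ) (t : Set.Icc (0 : ℝ) 1) => (t : ℝ) ^ n * (2 * Real.cos (n * θ)))
      (fun n => (integrable_pow_val n).mul_const _) (by
        refine Summable.of_nonneg_of_le (fun n => integral_nonneg fun t => norm_nonneg _)
          (fun n => ?_) (hmom.mul_right 2)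
        rw [← integral_mul_const]
        refine integral_mono ((integrable_pow_val n).mul_const _).norm
          ((integrable_pow_val n).mul_const _) fun t => ?_
        simp only [norm_mul, Real.norm_eq_abs, abs_of_nonneg (pow_nonneg t.2.1 n), abs_two]
        have h1 := Real.abs_cos_le_one (n * θ)
        have h2 := pow_nonneg t.2.1 n
        refine mul_le_mul_of_nonneg_left ?_ h2
        linarith)
    rw [symbol]
    convert! h using 1
    · funext n
      exact (integral_mul_const _ _).symm
    refine integral_congr_ae ?_
    filter_upwards [hone] with t ht
    exact (hasSum_pow_mul_cos t.2.1 ht θ).tsum_eq.symm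
  have hF := (summable_mul_exp (summable_norm_weight μ) θ).hasSum.nat_add_neg
  -- Pairing n with -n counts k = 0 twice, which explains the extra term at n = 0.
  have hterm : ∀ n : ℕ, weight μ n * Complex.exp ((n : ℤ) * θ * Complex.I) +
      weight μ (-n) * Complex.exp ((-n : ℤ) * θ * Complex.I) =
      (((∫ t : Set.Icc (0 : ℝ) 1, (t : ℝ) ^ n ∂ν) * (2 * Real.cos (n * θ)) : ℝ) : ℂ) +
        if n = 0 then weight μ 0 else 0 := by
    intro n
    rcases Nat.eq_zero_or_pos n with rfl | hn
    · simp [weight, hzero]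
      ring
    · rw [if_neg hn.ne', add_zero, ← hpow n hn]
      unfold weight
      rw [hsymm]
      push_cast
      rw [Complex.cos]
      ring_nf
  simp only [hterm] at hF
  have h0 : HasSum (fun n : ℕ => if n = 0 then weight μ 0 else 0) (weight μ 0) :=
    hasSum_ite_eq 0 _
  have hI' : HasSum (fun n : ℕ => ((((∫ t : Set.Icc (0 : ℝ) 1, (t : ℝ) ^ n ∂ν) *
      (2 * Real.cos (n * θ)) : ℝ) : ℂ))) ((symbol ν (1 - Real.cos θ) : ℝ) : ℂ) := by
    exact_mod_cast hI
  have := hF.unique (hI'.add h0)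
  simpa [trigSeries] using this

/-! ### Symmetric unimodal sequences -/

/-- A nonnegative symmetric summable sequence that is nonincreasing on `ℕ`. -/
structure SymmUnimodal (r : ℤ → ℝ) : Prop where
  nonneg : ∀ k, 0 ≤ r k
  neg : ∀ k, r (-k) = r k
  step : ∀ k, 0 ≤ k → r (k + 1) ≤ r k
  summable : Summable r

namespace SymmUnimodal

variable {r s : ℤ → ℝ}

theorem le_of_natAbs_le (h : SymmUnimodal r) {i j : ℤ} (hij : i.natAbs ≤ j.natAbs) : r j ≤ r i := by
  have habs : ∀ k : ℤ, r k = r (k.natAbs : ℤ) := fun k => by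
    rcases Int.natAbs_eq k with hk | hk
    · rw [← hk]
    · conv_lhs => rw [hk, h.neg]
  have hanti : Antitone fun n : ℕ => r n := antitone_nat_of_succ_le fun n => by
    push_cast
    exact h.step n (by positivity)
  rw [habs i, habs j]
  exact hanti hij

theorem summable_mul (hr : SymmUnimodal r) (hs : SymmUnimodal s) (e : ℤ ≃ ℤ) (e' : ℤ → ℤ) :
    Summable fun l => r (e l) * s (e' l) :=
  Summable.of_nonneg_of_le (fun _ => mul_nonneg (hr.nonneg _) (hs.nonneg _))
    (fun _ => mul_le_mul_of_nonneg_left (hs.le_of_natAbs_le (by simp)) (hr.nonneg _))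
    ((e.summable_iff.mpr hr.summable).mul_right (s 0))

/-- By symmetry of s, each side can be written as a sum in two ways. Adding both expressions, twice
the difference of the sides is Σ (r(i - l) - r(i + 1 + l))(s(l) - s(l + 1)). -/
theorem tsum_conv_step (hr : SymmUnimodal r) (hs : SymmUnimodal s) {i : ℤ} (hi : 0 ≤ i) :
    ∑' j, r j * s (i + 1 - j) ≤ ∑' j, r j * s (i - j) := by
  have sA := hr.summable_mul hs (Equiv.subLeft i) id
  have sB := hr.summable_mul hs (Equiv.addLeft (i + 1)) id
  have sC := hr.summable_mul hs (Equiv.addLeft (i + 1)) (· + 1)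
  have sD := hr.summable_mul hs (Equiv.subLeft i) (· + 1)
  simp only [Equiv.subLeft_apply, Equiv.coe_addLeft, id_eq] at sA sB sC sD
  have eA : ∑' j, r j * s (i - j) = ∑' l, r (i - l) * s l := by
    rw [← (Equiv.subLeft i).tsum_eq]
    simp
  have eC : ∑' j, r j * s (i - j) = ∑' l, r (i + 1 + l) * s (l + 1) := by
    rw [← (Equiv.addLeft (i + 1)).tsum_eq]
    refine tsum_congr fun l => ?_
    rw [Equiv.coe_addLeft, show i - (i + 1 + l) = -(l + 1) by ring, hs.neg]
  have eB : ∑' j, r j * s (i + 1 - j) = ∑' l, r (i + 1 + l) * s l := by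
    rw [← (Equiv.addLeft (i + 1)).tsum_eq]
    refine tsum_congr fun l => ?_
    rw [Equiv.coe_addLeft, show i + 1 - (i + 1 + l) = -l by ring, hs.neg]
  have eD : ∑' j, r j * s (i + 1 - j) = ∑' l, r (i - l) * s (l + 1) := by
    rw [← (Equiv.subLeft i).tsum_eq]
    refine tsum_congr fun l => ?_
    rw [Equiv.subLeft_apply, show i + 1 - (i - l) = l + 1 by ring]
  have key : 0 ≤ ∑' l, (r (i - l) * s l - r (i + 1 + l) * s l +
      (r (i + 1 + l) * s (l + 1) - r (i - l) * s (l + 1))) := by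
    refine tsum_nonneg fun l => ?_
    rw [show r (i - l) * s l - r (i + 1 + l) * s l +
      (r (i + 1 + l) * s (l + 1) - r (i - l) * s (l + 1)) =
      (r (i - l) - r (i + 1 + l)) * (s l - s (l + 1)) by ring]
    -- Since i ≥ 0, both factors are nonnegative for l ≥ 0 and nonpositive for l < 0.
    rcases le_or_gt 0 l with hl | hl
    · exact mul_nonneg (sub_nonneg.mpr (hr.le_of_natAbs_le (by omega)))
        (sub_nonneg.mpr (hs.le_of_natAbs_le (by omega)))
    · exact mul_nonneg_of_nonpos_of_nonpos (sub_nonpos.mpr (hr.le_of_natAbs_le (by omega)))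
        (sub_nonpos.mpr (hs.le_of_natAbs_le (by omega)))
  rw [(sA.sub sB).tsum_add (sC.sub sD), sA.tsum_sub sB, sC.tsum_sub sD, ← eA, ← eB, ← eC, ← eD]
    at key
  linarith

theorem conv_ofReal (r s : ℤ → ℝ) :
    conv (fun k => (r k : ℂ)) (fun k => (s k : ℂ)) = fun k => ((∑' j, r j * s (k - j) : ℝ) : ℂ) := by
  funext k
  rw [conv_apply, Complex.ofReal_tsum]
  push_cast
  rfl

theorem conv (hr : SymmUnimodal r) (hs : SymmUnimodal s) :
    SymmUnimodal fun k => ∑' j, r j * s (k - j) where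
  nonneg k := tsum_nonneg fun _ => mul_nonneg (hr.nonneg _) (hs.nonneg _)
  neg k := by
    rw [← (Equiv.neg ℤ).tsum_eq]
    refine tsum_congr fun l => ?_
    rw [Equiv.neg_apply, hr.neg, show -k - -l = -(k - l) by ring, hs.neg]
  step _ hk := hr.tsum_conv_step hs hk
  summable := by
    have h1 : Summable fun k => ‖(r k : ℂ)‖ := by
      simpa only [Complex.norm_real] using hr.summable.norm
    have h2 : Summable fun k => ‖(s k : ℂ)‖ := by
      simpa only [Complex.norm_real] using hs.summable.norm
    have h := summable_norm_conv h1 h2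
    rw [conv_ofReal] at h
    simp only [Complex.norm_real] at h
    exact h.of_norm

theorem delta : SymmUnimodal fun k => if k = 0 then 1 else 0 where
  nonneg k := by positivity
  neg k := by simp
  step k hk := by
    rw [if_neg (by omega)]
    positivity
  summable := (hasSum_ite_eq 0 (1 : ℝ)).summable

theorem summable_nat_succ (h : SymmUnimodal r) : Summable fun i : ℕ => r ((i : ℤ) + 1) :=
  h.summable.comp_injective (i := fun i : ℕ => (i : ℤ) + 1) fun a b hab => by simpa using hab

theorem tsum_nat_succ_le (h : SymmUnimodal r) : ∑' i : ℕ, r ((i : ℤ) + 1) ≤ ∑' k, r k :=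
  tsum_comp_le_tsum_of_inj h.summable h.nonneg (i := fun i : ℕ => (i : ℤ) + 1)
    fun a b hab => by simpa using hab

/-- The term x = (i + 1)r(i + 1) - i r(i) equals r(i + 1) minus the nonnegative i(r(i) - r(i + 1)),
so |x| ≤ 2r(i + 1) - x. The sum of the x telescopes to N r(N) ≥ 0 and can be dropped. -/
theorem sum_range_abs_scaleDiff_le (h : SymmUnimodal r) (N : ℕ) :
    ∑ i ∈ Finset.range N, |((i : ℝ) + 1) * r (i + 1) - i * r i| ≤ 2 * ∑' k, r k := by
  have h1 : ∀ i : ℕ, |((i : ℝ) + 1) * r (i + 1) - i * r i| ≤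
      2 * r (i + 1) - (((i : ℝ) + 1) * r (i + 1) - i * r i) := by
    intro i
    have h2 := h.step i (by positivity)
    have h3 : 0 ≤ (i : ℝ) * (r i - r (i + 1)) := mul_nonneg (by positivity) (by linarith)
    have h4 := h.nonneg (i + 1)
    rw [abs_le]
    constructor <;> linarith
  have h2 : ∑ i ∈ Finset.range N, (((i : ℝ) + 1) * r (i + 1) - i * r i) = N * r N := by
    have := Finset.sum_range_sub (fun i : ℕ => (i : ℝ) * r i) N
    push_cast at this
    rw [this]
    simp
  have h3 : ∑ i ∈ Finset.range N, r ((i : ℤ) + 1) ≤ ∑' k, r k :=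
    (h.summable_nat_succ.sum_le_tsum _ fun _ _ => h.nonneg _).trans h.tsum_nat_succ_le
  have h4 : 0 ≤ (N : ℝ) * r N := mul_nonneg (by positivity) (h.nonneg _)
  calc _ ≤ ∑ i ∈ Finset.range N,
        (2 * r (i + 1) - (((i : ℝ) + 1) * r (i + 1) - i * r i)) := Finset.sum_le_sum fun i _ => h1 i
    _ = 2 * ∑ i ∈ Finset.range N, r ((i : ℤ) + 1) - N * r N := by
        rw [Finset.sum_sub_distrib, h2, Finset.mul_sum]
    _ ≤ _ := by linarith

theorem summable_abs_scaleDiff (h : SymmUnimodal r) :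
    Summable (fun i : ℤ => |((i : ℝ) + 1) * r (i + 1) - i * r i|) ∧
      ∑' i : ℤ, |((i : ℝ) + 1) * r (i + 1) - i * r i| ≤ 4 * ∑' k, r k := by
  set f : ℤ → ℝ := fun i => |((i : ℝ) + 1) * r (i + 1) - i * r i| with hf
  have hneg : ∀ i : ℕ, f (-((i : ℤ) + 1)) = f i := by
    intro i
    simp only [hf]
    rw [show -((i : ℤ) + 1) + 1 = -i by ring, h.neg, h.neg]
    push_cast
    congr 1
    ring
  have hb : ∀ N, ∑ i ∈ Finset.range N, f i ≤ 2 * ∑' k, r k := fun N => by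
    simpa [hf] using h.sum_range_abs_scaleDiff_le N
  have s1 : Summable fun i : ℕ => f i := summable_of_sum_range_le (fun _ => abs_nonneg _) hb
  have s2 : Summable fun i : ℕ => f (-((i : ℤ) + 1)) := by simpa only [hneg] using s1
  have t1 := Real.tsum_le_of_sum_range_le (fun _ => abs_nonneg _) hb
  refine ⟨Summable.of_nat_of_neg_add_one s1 s2, ?_⟩
  rw [tsum_of_nat_of_neg_add_one s1 s2, tsum_congr hneg]
  linarith

end SymmUnimodal

/-! ### The derivation `a ↦ ((i + 1) a(i + 1) - i a(i))` -/

/-- `g(i) = (i + 1) a(i + 1) - i a(i)` for every `i`. -/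
def HasScaleDiff (a g : Ell1) : Prop :=
  ∀ i : ℤ, g.coe i = (i + 1) * a.coe (i + 1) - i * a.coe i

namespace HasScaleDiff

variable {a b g h : Ell1}

/-- The number j a(j) is, up to sign, a telescoping partial sum of g starting at 0. This boundedness
makes Σ j a(j)b(k - j) converge although j a(j) need not be summable. -/
theorem norm_mul_le (H : HasScaleDiff a g) (j : ℤ) : ‖j * a.coe j‖ ≤ ‖g‖ := by
  have hsum : ∀ (f : ℕ → ℤ), Function.Injective f → ∀ n : ℕ,
      ‖∑ i ∈ Finset.range n, g.coe (f i)‖ ≤ ‖g‖ := by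
    intro f hf n
    refine (norm_sum_le _ _).trans ?_
    rw [Ell1.norm_eq]
    exact ((g.summable.comp_injective hf).sum_le_tsum _ fun _ _ => norm_nonneg _).trans
      (tsum_comp_le_tsum_of_inj g.summable (fun _ => norm_nonneg _) hf)
  have h1 : ∀ n : ℕ, ∑ i ∈ Finset.range n, g.coe i = n * a.coe n := by
    intro n
    induction n with
    | zero => simp
    | succ n ih =>
      rw [Finset.sum_range_succ, ih, H]
      push_cast
      ring
  have h2 : ∀ n : ℕ, ∑ i ∈ Finset.range n, g.coe (-((i : ℤ) + 1)) = n * a.coe (-n) := by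
    intro n
    induction n with
    | zero => simp
    | succ n ih =>
      rw [Finset.sum_range_succ, ih, H]
      push_cast
      rw [show -((n : ℤ) + 1) + 1 = -n by ring]
      ring
  rcases Int.eq_nat_or_neg j with ⟨n, rfl | rfl⟩
  · rw [Int.cast_natCast, ← h1]
    exact hsum _ Nat.cast_injective n
  · rw [Int.cast_neg, Int.cast_natCast, neg_mul, norm_neg, ← h2]
    exact hsum _ (fun x y hxy => by simpa using hxy) n

/-- Writing i + 1 = j + (i + 1 - j) and i = j + (i - j) splits the weights between the two factors;
the sums containing j a(j) are matched by the shift j ↦ j + 1. -/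
theorem mul (Ha : HasScaleDiff a g) (Hb : HasScaleDiff b h) :
    HasScaleDiff (a * b) (g * b + a * h) := by
  intro i
  have hb : ∀ k : ℤ, Summable fun j : ℤ => ‖b.coe (k - j)‖ := fun k =>
    (Equiv.subLeft k).summable_iff.mpr b.summable
  have s1 : ∀ k : ℤ, Summable fun j : ℤ => a.coe j * b.coe (k - j) := fun k =>
    Summable.of_norm_bounded ((hb k).mul_left ‖a‖) fun j => by
      rw [norm_mul]
      exact mul_le_mul_of_nonneg_right (a.norm_coe_le j) (norm_nonneg _)
  have s2 : ∀ k : ℤ, Summable fun j : ℤ => j * a.coe j * b.coe (k - j) := fun k =>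
    Summable.of_norm_bounded ((hb k).mul_left ‖g‖) fun j => by
      rw [norm_mul]
      exact mul_le_mul_of_nonneg_right (Ha.norm_mul_le j) (norm_nonneg _)
  have e1 : ∑' j : ℤ, g.coe j * b.coe (i - j) =
      (∑' j : ℤ, j * a.coe j * b.coe (i + 1 - j)) - ∑' j : ℤ, j * a.coe j * b.coe (i - j) := by
    have hsh := (Equiv.addRight (1 : ℤ)).summable_iff.mpr (s2 (i + 1))
    have ht : ∑' j, ((fun j : ℤ => j * a.coe j * b.coe (i + 1 - j)) ∘ Equiv.addRight (1 : ℤ)) j =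
        ∑' j : ℤ, j * a.coe j * b.coe (i + 1 - j) := 
      (Equiv.addRight (1 : ℤ)).tsum_eq fun j : ℤ => (j : ℂ) * a.coe j * b.coe (i + 1 - j)
    rw [← ht, ← hsh.tsum_sub (s2 i)]
    refine tsum_congr fun j => ?_
    rw [Ha, Function.comp_apply, Equiv.coe_addRight, show i + 1 - (j + 1) = i - j by ring]
    push_cast
    ring
  have e2 : ∑' j : ℤ, a.coe j * h.coe (i - j) =
      (i + 1) * (∑' j : ℤ, a.coe j * b.coe (i + 1 - j)) - i * (∑' j : ℤ, a.coe j * b.coe (i - j)) -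
      ((∑' j : ℤ, j * a.coe j * b.coe (i + 1 - j)) - ∑' j : ℤ, j * a.coe j * b.coe (i - j)) := by
    rw [← tsum_mul_left, ← tsum_mul_left, ← ((s1 _).mul_left _).tsum_sub ((s1 _).mul_left _),
      ← (s2 _).tsum_sub (s2 _),
      ← (((s1 _).mul_left _).sub ((s1 _).mul_left _)).tsum_sub ((s2 _).sub (s2 _))]
    refine tsum_congr fun j => ?_
    rw [Hb, show i - j + 1 = i + 1 - j by ring]
    push_cast
    ring
  rw [Ell1.coe_add, Pi.add_apply, Ell1.coe_mul, Ell1.coe_mul, Ell1.coe_mul, conv_apply, conv_apply,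
    conv_apply, conv_apply, e1, e2]
  ring

theorem one : HasScaleDiff 1 0 := by
  intro i
  rw [Ell1.coe_one, Ell1.coe_zero]
  by_cases h0 : i = 0
  · simp [h0, delta]
  · by_cases h1 : i + 1 = 0
    · have : (i : ℂ) + 1 = 0 := by exact_mod_cast h1
      simp [delta, h0, this]
    · simp [delta, h0, h1]

theorem sub (Ha : HasScaleDiff a g) (Hb : HasScaleDiff b h) : HasScaleDiff (a - b) (g - h) := by
  intro i
  rw [Ell1.coe_sub, Ell1.coe_sub, Pi.sub_apply, Pi.sub_apply, Pi.sub_apply, Ha, Hb]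
  ring

theorem pow_succ (Ha : HasScaleDiff a g) (n : ℕ) :
    HasScaleDiff (a ^ (n + 1)) ((n + 1) • (a ^ n * g)) := by
  induction n with
  | zero => simpa using Ha
  | succ n ih =>
    have := ih.mul Ha
    rw [← _root_.pow_succ] at this
    convert! this using 1
    simp only [nsmul_eq_mul]
    push_cast
    ring

theorem unique (H : HasScaleDiff a g) (H' : HasScaleDiff a h) : g = h :=
  Ell1.ext (funext fun i => (H i).trans (H' i).symm)

end HasScaleDiff

theorem Ell1.coe_nsmul (n : ℕ) (x : Ell1) : (n • x).coe = n • x.coe := by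
  induction n with
  | zero => rw [zero_nsmul, zero_nsmul]; rfl
  | succ n ih => rw [succ_nsmul, succ_nsmul, Ell1.coe_add, ih]

theorem Ell1.norm_nsmul (n : ℕ) (x : Ell1) : ‖n • x‖ = n * ‖x‖ := by
  rw [Ell1.norm_eq, Ell1.norm_eq, Ell1.coe_nsmul, ← tsum_mul_left]
  refine tsum_congr fun k => ?_
  rw [Pi.smul_apply, nsmul_eq_mul, norm_mul, Complex.norm_natCast]

/-! ### Unimodal elements of ℓ¹(ℤ) and their powers. -/

/-- An element of `ℓ¹(ℤ)` whose coefficients form a symmetric unimodal sequence. -/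
def Ell1.IsUnimodal (a : Ell1) : Prop :=
  ∃ r : ℤ → ℝ, SymmUnimodal r ∧ a.coe = fun k => (r k : ℂ)

theorem Ell1.IsUnimodal.mul {a b : Ell1} (ha : a.IsUnimodal) (hb : b.IsUnimodal) :
    (a * b).IsUnimodal := by
  obtain ⟨r, hr, har⟩ := ha
  obtain ⟨s, hs, hbs⟩ := hb
  exact ⟨_, hr.conv hs, by rw [Ell1.coe_mul, har, hbs, SymmUnimodal.conv_ofReal]⟩

theorem Ell1.IsUnimodal.pow {a : Ell1} (ha : a.IsUnimodal) (n : ℕ) : (a ^ n).IsUnimodal := by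
  induction n with
  | zero =>
    refine ⟨_, SymmUnimodal.delta, ?_⟩
    rw [pow_zero, Ell1.coe_one]
    funext k
    by_cases hk : k = 0 <;> simp [RittSCM.delta, hk]
  | succ n ih =>
    rw [pow_succ]
    exact ih.mul ha

theorem Ell1.IsUnimodal.exists_hasScaleDiff {a : Ell1} (ha : a.IsUnimodal) :
    ∃ g : Ell1, HasScaleDiff a g ∧ ‖g‖ ≤ 4 * ‖a‖ := by
  obtain ⟨r, hr, har⟩ := ha
  obtain ⟨hs, ht⟩ := hr.summable_abs_scaleDiff
  have hn : ∀ i : ℤ, ‖(((i : ℝ) + 1) * r (i + 1) - i * r i : ℝ)‖ =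
      ‖((i : ℂ) + 1) * a.coe (i + 1) - i * a.coe i‖ := by
    intro i
    rw [har, ← Complex.norm_real]
    push_cast
    rfl
  simp_rw [← Real.norm_eq_abs, hn] at hs ht
  refine ⟨Ell1.mk _ hs, fun i => rfl, ?_⟩
  rw [Ell1.norm_eq, Ell1.norm_eq, Ell1.coe_mk]
  refine ht.trans_eq ?_
  congr 1
  refine tsum_congr fun k => ?_
  rw [har, Complex.norm_real, Real.norm_of_nonneg (hr.nonneg k)]

/-- By the Leibniz rule (n + 1)aⁿg is the scale difference of the unimodal element aⁿ⁺¹, whose norm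
is at most 1. The gain 1/(n + 1) thus comes from unimodality alone. -/
theorem Ell1.IsUnimodal.norm_pow_mul_scaleDiff_le {a g : Ell1} (ha : a.IsUnimodal)
    (ha1 : ‖a‖ ≤ 1) (Hg : HasScaleDiff a g) (n : ℕ) : (n + 1) * ‖a ^ n * g‖ ≤ 4 := by
  obtain ⟨h, Hh, hle⟩ := (ha.pow (n + 1)).exists_hasScaleDiff
  rw [Hh.unique (Hg.pow_succ n), Ell1.norm_nsmul] at hle
  push_cast at hle
  refine hle.trans ?_
  have := (norm_pow_le' a (Nat.succ_pos n)).trans (pow_le_one₀ (norm_nonneg _) ha1)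
  linarith

theorem IsSCM.isUnimodal {μ : Measure ℤ} [IsProbabilityMeasure μ] (h : IsSCM μ) :
    (Ell1.mk (weight μ) (summable_norm_weight μ)).IsUnimodal := by
  obtain ⟨ν, hν, -, -, -, hzero, hpow⟩ := h.exists_density
  refine ⟨fun k => μ.real {k}, ⟨fun _ => measureReal_nonneg, h.real_neg, fun k hk => ?_,
    (hasSum_real_singleton μ).summable⟩, rfl⟩
  lift k to ℕ using hk
  have h1 := hpow (k + 1) (by omega)
  push_cast at h1
  rw [h1]
  have hle : ∫ t : Set.Icc (0 : ℝ) 1, (t : ℝ) ^ (k + 1) ∂ν ≤ ∫ t : Set.Icc (0 : ℝ) 1, (t : ℝ) ^ k ∂ν :=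
    integral_mono (integrable_pow_val _) (integrable_pow_val _) fun t =>
      pow_le_pow_of_le_one t.2.1 t.2.2 (Nat.le_succ k)
  refine hle.trans ?_
  rcases Nat.eq_zero_or_pos k with rfl | hk0
  -- The value at 0 is twice the zeroth moment, so the step from 0 to 1 still goes down.
  · have : (0 : ℝ) ≤ ν.real Set.univ := measureReal_nonneg
    simp only [pow_zero, integral_const, smul_eq_mul, mul_one, Nat.cast_zero, hzero]
    linarith
  · rw [hpow k hk0]

/-! ### Bounds in the convolution algebra -/

/-- Half of the power of p goes to x and half to y. Each half q satisfies n + 1 ≤ 2(q + 1), whence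
the factor 2^(a + b). -/
theorem exists_bound_mul {p x y : Ell1} {a b : ℕ} {A B : ℝ}
    (hx : ∀ n : ℕ, ((n : ℝ) + 1) ^ a * ‖p ^ n * x‖ ≤ A)
    (hy : ∀ n : ℕ, ((n : ℝ) + 1) ^ b * ‖p ^ n * y‖ ≤ B) (n : ℕ) :
    ((n : ℝ) + 1) ^ (a + b) * ‖p ^ n * (x * y)‖ ≤ 2 ^ (a + b) * (A * B) := by
  obtain ⟨q, q', hq, h1, h2⟩ : ∃ q q' : ℕ, n = q + q' ∧ n + 1 ≤ 2 * (q + 1) ∧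
      n + 1 ≤ 2 * (q' + 1) := ⟨n / 2, n - n / 2, by omega, by omega, by omega⟩
  have h1' : (n : ℝ) + 1 ≤ 2 * (q + 1) := by exact_mod_cast h1
  have h2' : (n : ℝ) + 1 ≤ 2 * (q' + 1) := by exact_mod_cast h2
  have hA : 0 ≤ A := le_trans (by positivity) (hx 0)
  have e : p ^ n * (x * y) = (p ^ q * x) * (p ^ q' * y) := by
    rw [hq, pow_add]
    ring
  calc ((n : ℝ) + 1) ^ (a + b) * ‖p ^ n * (x * y)‖
      ≤ ((n : ℝ) + 1) ^ (a + b) * (‖p ^ q * x‖ * ‖p ^ q' * y‖) := by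
        rw [e]
        gcongr
        exact norm_mul_le _ _
    _ = (((n : ℝ) + 1) ^ a * ((n : ℝ) + 1) ^ b) * (‖p ^ q * x‖ * ‖p ^ q' * y‖) := by rw [pow_add]
    _ ≤ ((2 * ((q : ℝ) + 1)) ^ a * (2 * ((q' : ℝ) + 1)) ^ b) * (‖p ^ q * x‖ * ‖p ^ q' * y‖) := by
        gcongr
    _ = 2 ^ (a + b) * ((((q : ℝ) + 1) ^ a * ‖p ^ q * x‖) * (((q' : ℝ) + 1) ^ b * ‖p ^ q' * y‖)) := by
        rw [mul_pow, mul_pow, pow_add]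
        ring
    _ ≤ 2 ^ (a + b) * (A * B) := by
        gcongr
        · exact hx q
        · exact hy q'

theorem exists_bound_pow_mul_one_sub_pow {p : Ell1} (hp : ‖p‖ ≤ 1) {A : ℝ}
    (hA : ∀ n : ℕ, ((n : ℝ) + 1) * ‖p ^ n * (1 - p)‖ ≤ A) (m : ℕ) :
    ∃ C : ℝ, ∀ n : ℕ, ((n : ℝ) + 1) ^ m * ‖p ^ n * (1 - p) ^ m‖ ≤ C := by
  induction m with
  | zero =>
    refine ⟨max ‖(1 : Ell1)‖ 1, fun n => ?_⟩
    rw [pow_zero, pow_zero, one_mul, mul_one]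
    rcases Nat.eq_zero_or_pos n with rfl | hn
    · rw [pow_zero]
      exact le_max_left _ _
    · exact ((norm_pow_le' p hn).trans (pow_le_one₀ (norm_nonneg _) hp)).trans (le_max_right _ _)
  | succ m ih =>
    obtain ⟨C, hC⟩ := ih
    refine ⟨2 ^ (m + 1) * (C * A), fun n => ?_⟩
    have := exists_bound_mul (b := 1) hC (by simpa using hA) n
    rwa [← pow_succ] at this

/-- By the Leibniz rule the scale difference of pⁿ(1 - p)^m is npⁿ⁻¹(1 - p)^m g - mpⁿ(1 - p)^(m-1)
g. In both terms g and each factor 1 - p gain one power of 1/n, so both are O(n^(-m)). -/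
theorem exists_scaleDiff_bound {p g : Ell1} (hp : ‖p‖ ≤ 1) (Hg : HasScaleDiff p g) {A B : ℝ}
    (hA : ∀ n : ℕ, ((n : ℝ) + 1) * ‖p ^ n * (1 - p)‖ ≤ A)
    (hB : ∀ n : ℕ, ((n : ℝ) + 1) * ‖p ^ n * g‖ ≤ B) (m : ℕ) :
    ∃ C : ℝ, ∀ n : ℕ, 1 ≤ n → ∃ h : Ell1, HasScaleDiff (p ^ n * (1 - p) ^ m) h ∧
      (n : ℝ) ^ m * (‖p ^ n * (1 - p) ^ m‖ + ‖h‖) ≤ C := by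
  obtain ⟨C₀, hC₀⟩ := exists_bound_pow_mul_one_sub_pow hp hA m
  have hB1 : ∀ n : ℕ, ((n : ℝ) + 1) ^ 1 * ‖p ^ n * g‖ ≤ B := by simpa using hB
  obtain ⟨D, e, He, hD⟩ : ∃ (D : ℝ) (e : Ell1), HasScaleDiff ((1 - p) ^ m) e ∧
      ∀ n : ℕ, ((n : ℝ) + 1) ^ m * ‖p ^ n * e‖ ≤ D := by
    -- For m = 0 the factor is the unit, whose scale difference is 0.
    rcases m with _ | m
    · exact ⟨0, 0, by simpa using HasScaleDiff.one, by simp⟩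
    · obtain ⟨C₁, hC₁⟩ := exists_bound_pow_mul_one_sub_pow hp hA m
      refine ⟨(m + 1) * (2 ^ (m + 1) * (C₁ * B)), _, (HasScaleDiff.one.sub Hg).pow_succ m,
        fun n => ?_⟩
      have h := exists_bound_mul hC₁ hB1 n
      have e1 : p ^ n * ((m + 1) • ((1 - p) ^ m * (0 - g))) =
          (m + 1) • -(p ^ n * ((1 - p) ^ m * g)) := by
        rw [mul_smul_comm]
        congr 1
        ring
      rw [e1, Ell1.norm_nsmul, norm_neg]
      push_cast
      calc _ = ((m : ℝ) + 1) * (((n : ℝ) + 1) ^ (m + 1) * ‖p ^ n * ((1 - p) ^ m * g)‖) := by ring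
        _ ≤ _ := by gcongr
  refine ⟨C₀ + (2 ^ (m + 1) * (C₀ * B) + D), fun n hn => ?_⟩
  obtain ⟨k, rfl⟩ : ∃ k, n = k + 1 := ⟨n - 1, by omega⟩
  refine ⟨_, (Hg.pow_succ k).mul He, ?_⟩
  have h1 := exists_bound_mul hC₀ hB1 k
  have h2 := hD (k + 1)
  have h3 := hC₀ (k + 1)
  have e1 : (k + 1) • (p ^ k * g) * (1 - p) ^ m = (k + 1) • (p ^ k * ((1 - p) ^ m * g)) := by
    rw [smul_mul_assoc]
    congr 1
    ring
  have hle : (((k + 1 : ℕ) : ℝ)) ^ m ≤ (((k + 1 : ℕ) : ℝ) + 1) ^ m := by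
    gcongr
    linarith
  rw [e1, mul_add]
  refine add_le_add (le_trans (by gcongr) h3) ?_
  calc _ ≤ ((k + 1 : ℕ) : ℝ) ^ m * (‖(k + 1) • (p ^ k * ((1 - p) ^ m * g))‖ + ‖p ^ (k + 1) * e‖) := by
        gcongr
        exact norm_add_le _ _
    _ = ((k : ℝ) + 1) ^ (m + 1) * ‖p ^ k * ((1 - p) ^ m * g)‖ +
        ((k + 1 : ℕ) : ℝ) ^ m * ‖p ^ (k + 1) * e‖ := by
        rw [Ell1.norm_nsmul]
        push_cast
        ring
    _ ≤ _ := add_le_add h1 (le_trans (by gcongr) h2)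

/-! ### The Hardy–Littlewood maximal inequality on `ℤ` -/

theorem int_closedBall_natCast (x : ℤ) (n : ℕ) :
    Metric.closedBall x (n : ℝ) = Set.Icc (x - n) (x + n) := by
  rw [Int.closedBall_eq_Icc]
  have h1 : ⌈(x : ℝ) - n⌉ = x - n := by exact_mod_cast Int.ceil_intCast (R := ℝ) (x - n)
  have h2 : ⌊(x : ℝ) + n⌋ = x + n := by exact_mod_cast Int.floor_intCast (R := ℝ) (x + n)
  rw [h1, h2]

theorem count_closedBall_natCast (x : ℤ) (n : ℕ) :
    Measure.count (Metric.closedBall x (n : ℝ)) = 2 * (n : ℝ≥0∞) + 1 := by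
  rw [int_closedBall_natCast, ← Finset.coe_Icc, Measure.count_apply_finset, Int.card_Icc,
    show (x + n + 1 - (x - n)).toNat = 2 * n + 1 by omega]
  push_cast
  rfl

theorem withDensity_count_apply (F : ℤ → ℝ≥0∞) (s : Set ℤ) :
    (Measure.count.withDensity F) s = ∑' y, s.indicator F y := by
  rw [withDensity_apply _ s.to_countable.measurableSet,
    ← lintegral_indicator s.to_countable.measurableSet, lintegral_count]

/-- The Hardy–Littlewood weak type `(1,1)` inequality on `ℤ`. -/
theorem mul_count_maximal_le (F : ℤ → ℝ≥0∞) (hF : ∑' y, F y ≠ ∞) {c : ℝ≥0∞} (hc0 : c ≠ 0)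
    (hc : c ≠ ∞) :
    c * Measure.count {x : ℤ | ∃ r : ℕ, c * (2 * r + 1) <
      Measure.count.withDensity F (Metric.closedBall x (r : ℝ))} ≤ 4 * ∑' y, F y := by
  set ρ := Measure.count.withDensity F
  have hρ : ∀ s, ρ s ≤ ∑' y, F y := fun s => by
    rw [withDensity_count_apply]
    exact ENNReal.tsum_le_tsum fun y => Set.indicator_le_self _ _ _
  set E := {x : ℤ | ∃ r : ℕ, c * (2 * r + 1) < ρ (Metric.closedBall x (r : ℝ))} with hE
  choose! r hr using fun x (hx : x ∈ E) => hx
  -- Vitali's lemma needs bounded radii; they are bounded because c r is at most the total mass.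
  have hR : ∀ x ∈ E, (r x : ℝ) ≤ ((∑' y, F y) / c).toReal := by
    intro x hx
    have h1 : (r x : ℝ≥0∞) ≤ (∑' y, F y) / c := by
      rw [ENNReal.le_div_iff_mul_le (Or.inl hc0) (Or.inl hc), mul_comm]
      refine le_trans ?_ ((hr x hx).le.trans (hρ _))
      gcongr
      calc (r x : ℝ≥0∞) = 1 * r x + 0 := by simp
        _ ≤ 2 * r x + 1 := by gcongr <;> simp
    have := ENNReal.toReal_mono (ENNReal.div_ne_top hF hc0) h1
    simpa using this
  -- Any enlargement factor above 3 is allowed. With 4 the enlarged ball has 8r + 1 ≤ 4(2r + 1)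
  -- points, which produces the constant 4.
  obtain ⟨u, huE, hdisj, hcov⟩ := Vitali.exists_disjoint_subfamily_covering_enlargement_closedBall
    E (fun x => x) (fun x => (r x : ℝ)) _ hR 4 (by norm_num)
  have hsub : E ⊆ ⋃ b ∈ u, Metric.closedBall b ((4 * r b : ℕ) : ℝ) := by
    intro x hx
    obtain ⟨b, hb, hxb⟩ := hcov x hx
    refine Set.mem_biUnion hb ?_
    push_cast
    exact hxb (Metric.mem_closedBall_self (by positivity))
  calc c * Measure.count E ≤ c * ∑' b : u, Measure.count
        (Metric.closedBall (b : ℤ) ((4 * r b : ℕ) : ℝ)) := by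
        gcongr
        exact (measure_mono hsub).trans (measure_biUnion_le _ u.to_countable _)
    _ ≤ ∑' b : u, 4 * ρ (Metric.closedBall (b : ℤ) (r b : ℝ)) := by
        rw [← ENNReal.tsum_mul_left]
        refine ENNReal.tsum_le_tsum fun b => ?_
        rw [count_closedBall_natCast]
        calc c * (2 * ((4 * r b : ℕ) : ℝ≥0∞) + 1) ≤ c * (2 * ((4 * r b : ℕ) : ℝ≥0∞) + 4) := by
              gcongr
              norm_num
          _ = 4 * (c * (2 * r b + 1)) := by
              push_cast
              ring
          _ ≤ _ := by
              gcongr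
              exact (hr b (huE b.2)).le
    _ = 4 * ρ (⋃ b ∈ u, Metric.closedBall b (r b : ℝ)) := by
        rw [ENNReal.tsum_mul_left, measure_biUnion u.to_countable hdisj
          fun b _ => Metric.isClosed_closedBall.measurableSet]
    _ ≤ 4 * ∑' y, F y := by
        gcongr
        exact hρ _

/-! ### Pointwise domination by averages -/

/-- The coefficients tend to 0, so K(j) is the sum of the steps from j outwards, towards +∞ if j ≥ 0
and towards -∞ if j < 0. All of them have index at least |j| in absolute value. -/
theorem enorm_le_tsum_step (K : Ell1) (j : ℤ) :
    ‖K.coe j‖ₑ ≤ ∑' i : ℤ, if j.natAbs ≤ i.natAbs then ‖K.coe i - K.coe (i + 1)‖ₑ else 0 := by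
  set g : ℤ → ℝ≥0∞ := fun i =>
    if j.natAbs ≤ i.natAbs then ‖K.coe i - K.coe (i + 1)‖ₑ else 0 with hg
  have hz : ∀ e : ℕ → ℤ, Function.Injective e →
      Filter.Tendsto (fun n => ‖K.coe (e n)‖ₑ) Filter.atTop (nhds 0) := by
    intro e he
    have h1 := (K.summable.comp_injective he).tendsto_atTop_zero
    have h2 := (ENNReal.continuous_ofReal.tendsto 0).comp h1
    simpa [Function.comp_def] using h2
  have hfin : ∀ e : ℕ → ℤ, Function.Injective e → ∀ n : ℕ,
      ∑ i ∈ Finset.range n, g (e i) ≤ ∑' i, g i := fun e he n =>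
    (ENNReal.sum_le_tsum _).trans (ENNReal.tsum_comp_le_tsum_of_injective he g)
  rcases le_or_gt 0 j with hj | hj
  · have hstep : ∀ n : ℕ, ‖K.coe j‖ₑ ≤
        ∑ i ∈ Finset.range n, g (j + i) + ‖K.coe (j + n)‖ₑ := by
      intro n
      induction n with
      | zero => simp
      | succ n ih =>
        refine ih.trans ?_
        rw [Finset.sum_range_succ, add_assoc]
        refine add_le_add le_rfl ?_
        have : g (j + n) = ‖K.coe (j + n) - K.coe (j + n + 1)‖ₑ := if_pos (by omega)
        rw [this]
        push_cast
        rw [← add_assoc]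
        calc ‖K.coe (j + n)‖ₑ = ‖(K.coe (j + n) - K.coe (j + n + 1)) + K.coe (j + n + 1)‖ₑ := by
              rw [sub_add_cancel]
          _ ≤ _ := enorm_add_le _ _
    have hinj : Function.Injective fun i : ℕ => j + (i : ℤ) := fun a b h => by simpa using h
    have := (hz _ hinj).const_add (∑' i, g i)
    rw [add_zero] at this
    exact ge_of_tendsto' this fun n => (hstep n).trans (add_le_add (hfin _ hinj n) le_rfl)
  · have hstep : ∀ n : ℕ, ‖K.coe j‖ₑ ≤
        ∑ i ∈ Finset.range n, g (j - 1 - i) + ‖K.coe (j - n)‖ₑ := by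
      intro n
      induction n with
      | zero => simp
      | succ n ih =>
        refine ih.trans ?_
        rw [Finset.sum_range_succ, add_assoc]
        refine add_le_add le_rfl ?_
        have : g (j - 1 - n) = ‖K.coe (j - 1 - n) - K.coe (j - 1 - n + 1)‖ₑ := if_pos (by omega)
        rw [this, show j - 1 - (n : ℤ) + 1 = j - n by ring,
          show j - ((n + 1 : ℕ) : ℤ) = j - 1 - n by push_cast; ring]
        calc ‖K.coe (j - n)‖ₑ = ‖K.coe (j - 1 - n) - (K.coe (j - 1 - n) - K.coe (j - n))‖ₑ := by
              rw [sub_sub_cancel]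
          _ ≤ _ := (enorm_sub_le).trans_eq (add_comm _ _)
    have hinj : Function.Injective fun i : ℕ => j - 1 - (i : ℤ) := fun a b h => by simpa using h
    have hinj' : Function.Injective fun i : ℕ => j - (i : ℤ) := fun a b h => by simpa using h
    have := (hz _ hinj').const_add (∑' i, g i)
    rw [add_zero] at this
    exact ge_of_tendsto' this fun n => (hstep n).trans (add_le_add (hfin _ hinj n) le_rfl)

/-- The identity i(K(i) - K(i + 1)) = K(i + 1) - h(i) trades the weight |i| for h and a shift of K.
-/
theorem tsum_step_le {K h : Ell1} (H : HasScaleDiff K h) :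
    ∑' i : ℤ, (2 * (i.natAbs : ℝ≥0∞) + 1) * ‖K.coe i - K.coe (i + 1)‖ₑ ≤
      ENNReal.ofReal (4 * (‖K‖ + ‖h‖)) := by
  have hpt : ∀ i : ℤ, (2 * (i.natAbs : ℝ≥0∞) + 1) * ‖K.coe i - K.coe (i + 1)‖ₑ ≤
      2 * ‖h.coe i‖ₑ + 3 * ‖K.coe (i + 1)‖ₑ + ‖K.coe i‖ₑ := by
    intro i
    have e1 : (i : ℂ) * (K.coe i - K.coe (i + 1)) = K.coe (i + 1) - h.coe i := by
      rw [H i]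
      ring
    have e2 : (i.natAbs : ℝ≥0∞) * ‖K.coe i - K.coe (i + 1)‖ₑ = ‖K.coe (i + 1) - h.coe i‖ₑ := by
      rw [← e1, enorm_mul]
      congr 1
      rw [← ofReal_norm, Complex.norm_intCast, ← Int.cast_abs, Int.abs_eq_natAbs, Int.cast_natCast,
        ENNReal.ofReal_natCast]
    calc _ = 2 * ((i.natAbs : ℝ≥0∞) * ‖K.coe i - K.coe (i + 1)‖ₑ) + ‖K.coe i - K.coe (i + 1)‖ₑ := by
          ring
      _ ≤ 2 * (‖K.coe (i + 1)‖ₑ + ‖h.coe i‖ₑ) + (‖K.coe i‖ₑ + ‖K.coe (i + 1)‖ₑ) := by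
          rw [e2]
          gcongr <;> exact enorm_sub_le
      _ = _ := by ring
  refine (ENNReal.tsum_le_tsum hpt).trans ?_
  have hshift : ∑' i : ℤ, ‖K.coe (i + 1)‖ₑ = ∑' i, ‖K.coe i‖ₑ :=
    (Equiv.addRight (1 : ℤ)).tsum_eq fun i => ‖K.coe i‖ₑ
  rw [ENNReal.tsum_add, ENNReal.tsum_add, ENNReal.tsum_mul_left, ENNReal.tsum_mul_left, hshift,
    Ell1.enorm_eq, Ell1.enorm_eq]
  calc _ = 4 * ENNReal.ofReal ‖K‖ + 2 * ENNReal.ofReal ‖h‖ := by ring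
    _ ≤ 4 * ENNReal.ofReal ‖K‖ + 4 * ENNReal.ofReal ‖h‖ := by
        gcongr
        norm_num
    _ = _ := by
        rw [ENNReal.ofReal_mul (by norm_num), ENNReal.ofReal_add (norm_nonneg _) (norm_nonneg _)]
        simp [mul_add]

/-- |K| is at most the superposition of the indicators of {|j| ≤ |i|} with masses |K(i) - K(i + 1)|,
and each of these balls has 2|i| + 1 points. -/
theorem enorm_conv_le_of_forall_average_le (K : Ell1) (f : ℤ → ℂ) (x : ℤ) {c : ℝ≥0∞}
    (hx : ∀ r : ℕ, Measure.count.withDensity (fun y => ‖f y‖ₑ) (Metric.closedBall x (r : ℝ)) ≤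
      c * (2 * r + 1)) :
    ‖conv K.coe f x‖ₑ ≤
      c * ∑' i : ℤ, (2 * (i.natAbs : ℝ≥0∞) + 1) * ‖K.coe i - K.coe (i + 1)‖ₑ := by
  have hball : ∀ r : ℕ, ∑' j : ℤ, (if j.natAbs ≤ r then ‖f (x - j)‖ₑ else 0) ≤
      c * (2 * r + 1) := by
    intro r
    refine le_trans (le_of_eq ?_) (hx r)
    rw [withDensity_count_apply, ← (Equiv.subLeft x).tsum_eq]
    refine tsum_congr fun y => ?_
    rw [Equiv.subLeft_apply, int_closedBall_natCast, sub_sub_cancel]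
    by_cases hy : y ∈ Set.Icc (x - r) (x + r)
    · rw [Set.indicator_of_mem hy, if_pos (by rw [Set.mem_Icc] at hy; omega)]
    · rw [Set.indicator_of_notMem hy, if_neg (by rw [Set.mem_Icc] at hy; omega)]
  calc ‖conv K.coe f x‖ₑ ≤ ∑' j : ℤ, ‖K.coe j * f (x - j)‖ₑ := by
        rw [conv_apply]
        exact enorm_tsum_le_tsum_enorm
    _ ≤ ∑' j : ℤ, ∑' i : ℤ, ‖K.coe i - K.coe (i + 1)‖ₑ *
          (if j.natAbs ≤ i.natAbs then ‖f (x - j)‖ₑ else 0) := by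
        refine ENNReal.tsum_le_tsum fun j => ?_
        rw [enorm_mul]
        refine (mul_le_mul_left (enorm_le_tsum_step K j) _).trans_eq ?_
        rw [← ENNReal.tsum_mul_right]
        refine tsum_congr fun i => ?_
        split_ifs <;> simp
    _ = ∑' i : ℤ, ‖K.coe i - K.coe (i + 1)‖ₑ *
          ∑' j : ℤ, (if j.natAbs ≤ i.natAbs then ‖f (x - j)‖ₑ else 0) := by
        rw [ENNReal.tsum_comm]
        exact tsum_congr fun i => ENNReal.tsum_mul_left
    _ ≤ ∑' i : ℤ, ‖K.coe i - K.coe (i + 1)‖ₑ * (c * (2 * (i.natAbs : ℝ≥0∞) + 1)) := by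
        gcongr with i
        exact hball _
    _ = _ := by
        rw [← ENNReal.tsum_mul_left]
        exact tsum_congr fun i => by ring

/-! ### Conclusion -/

theorem weakTypeMaximal_of_scaleDiff_bound {μ : Measure ℤ} {p : Ell1} (hp : p.coe = weight μ)
    (m : ℕ) {C : ℝ} (hC : ∀ n : ℕ, 1 ≤ n → ∃ h : Ell1, HasScaleDiff (p ^ n * (1 - p) ^ m) h ∧
      (n : ℝ) ^ m * (‖p ^ n * (1 - p) ^ m‖ + ‖h‖) ≤ C) : WeakTypeMaximal μ m := by
  have hC0 : 0 ≤ C := by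
    obtain ⟨h, -, hh⟩ := hC 1 le_rfl
    exact le_trans (by positivity) hh
  -- The factor 4 is the one of `tsum_step_le`; the added 1 makes B positive even if C = 0.
  set B : ℝ := 4 * C + 1 with hB
  have hBpos : 0 < B := by positivity
  refine ⟨8 * B, by positivity, fun f => iSup₂_le fun s hs => ?_⟩
  have hf : ∑' y, ‖f y‖ₑ = ENNReal.ofReal ‖f‖ := Ell1.enorm_eq f
  -- With this threshold, averages at most c force the maximal function to be at most s/2, strictly
  -- below s.
  set c : ℝ≥0∞ := ENNReal.ofReal (s / (2 * B)) with hc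
  have hc0 : c ≠ 0 := by
    rw [hc, ne_eq, ENNReal.ofReal_eq_zero, not_le]
    positivity
  have hmax := mul_count_maximal_le (fun y => ‖f y‖ₑ) (by rw [hf]; exact ENNReal.ofReal_ne_top)
    hc0 ENNReal.ofReal_ne_top
  have hsub : {k : ℤ | ENNReal.ofReal s ≤ maximalFunction μ m f k} ⊆
      {x : ℤ | ∃ r : ℕ, c * (2 * r + 1) < Measure.count.withDensity (fun y => ‖f y‖ₑ)
        (Metric.closedBall x (r : ℝ))} := by
    intro x hx
    by_contra hcon
    simp only [Set.mem_ofPred_eq, not_exists, not_lt] at hcon hx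
    have hle : maximalFunction μ m f x ≤ ENNReal.ofReal (s / 2) := by
      refine iSup₂_le fun n hn => ?_
      obtain ⟨h, H, hh⟩ := hC n hn
      have hker : conv (convPow (weight μ) n) (convPow (delta - weight μ) m) =
          (p ^ n * (1 - p) ^ m).coe := by
        rw [Ell1.coe_mul, Ell1.coe_pow, Ell1.coe_pow, Ell1.coe_sub, Ell1.coe_one, hp]
      rw [hker]
      calc (n : ℝ≥0∞) ^ m * ‖conv (p ^ n * (1 - p) ^ m).coe f x‖ₑ
          ≤ (n : ℝ≥0∞) ^ m * (c * ENNReal.ofReal (4 * (‖p ^ n * (1 - p) ^ m‖ + ‖h‖))) := by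
            gcongr
            exact (enorm_conv_le_of_forall_average_le _ f x hcon).trans
              (mul_le_mul_right (tsum_step_le H) c)
        _ = ENNReal.ofReal ((n : ℝ) ^ m * (s / (2 * B) * (4 * (‖p ^ n * (1 - p) ^ m‖ + ‖h‖)))) := by
            rw [ENNReal.ofReal_mul (p := (n : ℝ) ^ m) (by positivity),
              ENNReal.ofReal_mul (p := s / (2 * B)) (by positivity),
              ENNReal.ofReal_pow (by positivity), ENNReal.ofReal_natCast]
        _ ≤ ENNReal.ofReal (s / 2) := by
            refine ENNReal.ofReal_le_ofReal ?_
            calc _ = s / (2 * B) * (4 * ((n : ℝ) ^ m * (‖p ^ n * (1 - p) ^ m‖ + ‖h‖))) := by ring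
              _ ≤ s / (2 * B) * B := by
                  gcongr
                  linarith
              _ = s / 2 := by field_simp
    have := (ENNReal.ofReal_le_ofReal_iff (by positivity)).mp (hx.trans hle)
    linarith
  have hcount : (({k : ℤ | ENNReal.ofReal s ≤ maximalFunction μ m f k}.encard : ℕ∞) : ℝ≥0∞) ≤
      Measure.count {x : ℤ | ∃ r : ℕ, c * (2 * r + 1) <
        Measure.count.withDensity (fun y => ‖f y‖ₑ) (Metric.closedBall x (r : ℝ))} := by
    rw [← Measure.count_apply (Set.to_countable _).measurableSet]
    exact measure_mono hsub
  have hs2 : ENNReal.ofReal s = ENNReal.ofReal (2 * B) * c := by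
    rw [hc, ← ENNReal.ofReal_mul (by positivity)]
    congr 1
    field_simp
  calc _ ≤ ENNReal.ofReal (2 * B) * (c * Measure.count {x : ℤ | ∃ r : ℕ, c * (2 * r + 1) <
        Measure.count.withDensity (fun y => ‖f y‖ₑ) (Metric.closedBall x (r : ℝ))}) := by
        rw [← mul_assoc, ← hs2]
        gcongr
    _ ≤ ENNReal.ofReal (2 * B) * (4 * ENNReal.ofReal ‖f‖) := by
        rw [← hf]
        gcongr
    _ = ENNReal.ofReal (8 * B * ‖f‖) := by
        rw [show (4 : ℝ≥0∞) = ENNReal.ofReal 4 by simp, ← ENNReal.ofReal_mul (by norm_num),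
          ← ENNReal.ofReal_mul (by positivity)]
        congr 1
        ring

theorem isRitt_of_norm_bound {μ : Measure ℤ} {p : Ell1} (hp : p.coe = weight μ) {A : ℝ}
    (hA : ∀ n : ℕ, ((n : ℝ) + 1) * ‖p ^ n * (1 - p)‖ ≤ A) : IsRitt μ := by
  refine (iSup₂_le fun n _ => ?_ : _ ≤ ENNReal.ofReal A).trans_lt ENNReal.ofReal_lt_top
  have e : ∀ k, convPow (weight μ) n k - convPow (weight μ) (n + 1) k =
      (p ^ n * (1 - p)).coe k := by
    intro k
    rw [mul_sub, mul_one, ← pow_succ, Ell1.coe_sub, Ell1.coe_pow, Ell1.coe_pow, hp, Pi.sub_apply]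
  simp_rw [e]
  rw [Ell1.enorm_eq, ← ENNReal.ofReal_natCast, ← ENNReal.ofReal_mul (by positivity)]
  refine ENNReal.ofReal_le_ofReal (le_trans ?_ (hA n))
  gcongr
  linarith

/-- Every SCM probability measure satisfies the Ritt estimate, in the algebra `ℓ¹(ℤ)`. -/
theorem IsSCM.exists_ritt_bound {μ : Measure ℤ} [IsProbabilityMeasure μ] (h : IsSCM μ) {p : Ell1}
    (hp : p.coe = weight μ) : ∃ A : ℝ, ∀ n : ℕ, ((n : ℝ) + 1) * ‖p ^ n * (1 - p)‖ ≤ A := by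
  obtain ⟨ν, hν, hint, hval, hone, hzero, hpow⟩ := h.exists_density
  have hF : ∀ θ, trigSeries p.coe θ = (symbol ν (1 - Real.cos θ) : ℝ) := fun θ => by
    rw [hp, trigSeries_weight h.real_neg hone hzero hpow]
  -- The Fourier estimate concerns exponents N + 2, so n = 0 and n = 1 enter through their own
  -- values; the factor 3 comes from N + 3 ≤ 3(N + 1).
  refine ⟨max (max ‖1 - p‖ (2 * ‖p * (1 - p)‖)) (3 * (1 + 50 * Real.pi ^ 2)), fun n => ?_⟩
  rcases n with _ | _ | N
  · simp
  · refine le_trans (le_of_eq ?_) (le_max_of_le_left (le_max_right _ _))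
    norm_num
  · refine le_trans ?_ (le_max_right _ _)
    have h1 := norm_pow_mul_one_sub_le hint hval hone hF N
    rw [le_div_iff₀ (by positivity)] at h1
    have h2 : (((N + 1 + 1 : ℕ) : ℝ) + 1) ≤ 3 * (N + 1) := by
      push_cast
      have : (0 : ℝ) ≤ N := by positivity
      linarith
    calc _ ≤ 3 * ((N : ℝ) + 1) * ‖p ^ (N + 2) * (1 - p)‖ := by gcongr
      _ ≤ _ := by linarith

end RittSCM

/-- The Ritt property and the maximal inequalities hold for every SCM probability measure: the
proof does not use the moment conditions `hcond`. -/
theorem theorem5p1 (μ : Measure ℤ) [IsProbabilityMeasure μ] (hμ : RittSCM.IsSCM μ)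
    (hcond : RittSCM.FirstMomentCondition μ ∨ RittSCM.SecondMomentCondition μ) :
    RittSCM.IsRitt μ ∧ ∀ m : ℕ, RittSCM.WeakTypeMaximal μ m := by
  obtain ⟨p, hp⟩ : ∃ p : RittSCM.Ell1, p = RittSCM.Ell1.mk (RittSCM.weight μ)
    (RittSCM.summable_norm_weight μ) := ⟨_, rfl⟩
  have hpc : p.coe = RittSCM.weight μ := by rw [hp, RittSCM.Ell1.coe_mk]
  have hp1 : ‖p‖ ≤ 1 := by
    rw [RittSCM.Ell1.norm_eq, hpc]
    simp_rw [RittSCM.norm_weight]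
    exact (RittSCM.hasSum_real_singleton μ).tsum_eq.le
  have huni : p.IsUnimodal := hp ▸ hμ.isUnimodal
  obtain ⟨A, hA⟩ := hμ.exists_ritt_bound hpc
  obtain ⟨g, Hg, -⟩ := huni.exists_hasScaleDiff
  refine ⟨RittSCM.isRitt_of_norm_bound hpc hA, fun m => ?_⟩
  obtain ⟨C, hC⟩ := RittSCM.exists_scaleDiff_bound hp1 Hg hA
    (fun n => huni.norm_pow_mul_scaleDiff_le hp1 Hg n) m
  exact RittSCM.weakTypeMaximal_of_scaleDiff_bound hpc m hC
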